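/- Let $K$ be an algebraically closed field of characteristic $0$, let $i\in K$ satisfy $i^2=-1$, and let $\mathbb{Q}(i)\subset K$. A linear algebraic group is a Zariski-closed subgroup $G$ of some $\mathrm{SL}_n(K)$; it is defined over a subfield $k\subseteq K$ if the ideal of polynomials over $K$ vanishing on $G$ is generated by polynomials with coefficients in $k$. A connected nonabelian algebraic group defined over $k$ is called $k$-simple if it has no nontrivial proper closed connected normal subgroup defined over $k$, and absolutely simple if it is $K$-simple. Choose any basis of $\mathbb{Q}(i)$ over $\mathbb{Q}$, let $\rho_0:\mathbb{Q}(i)\to M_2(\mathbb{Q})$ be the regular representation in this basis, and let $H=\mathcal{R}_{\mathbb{Q}(i)/\mathbb{Q}}\mathrm{SL}_2\le \mathrm{SL}_4(K)$ be the restriction of scalars of $\mathrm{SL}_2$: the group of all $4\times 4$ matrices consisting of four $2\times 2$ blocks $z^{st}$ ($s,t\in\{1,2\}$) that lie in the $K$-span of $\rho_0(\mathbb{Q}(i))$ and satisfy $z^{11}z^{22}-z^{12}z^{21}=1$ in $M_2(K)$. Then: (1) $H$ is $\mathbb{Q}$-simple (in particular it is a connected nonabelian algebraic group defined over $\mathbb{Q}$);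 (2) $H$ is not absolutely simple; (3) there is an isomorphism of algebraic groups $\rho:H\to \mathrm{SL}_2\times\mathrm{SL}_2$ such that $\rho$ and $\rho^{-1}$ are given by polynomials with coefficients in $\mathbb{Q}(i)$, and complex conjugation swaps the two factors: if $\tau$ is the automorphism of $\mathbb{Q}(i)$ with $\tau(i)=-i$ and $s(x,y)=(y,x)$, then applying $\tau$ to the coefficients of suitable polynomials over $\mathbb{Q}(i)$ defining $\rho$ gives $\rho^\tau=s\circ\rho$. Moreover, for every field automorphism $\sigma$ of $K$ with $\sigma(i)=-i$ and every $h\in H$, one has $\sigma(h)\in H$ and $\rho(\sigma(h))=\sigma(s(\rho(h)))$. -/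

import Mathlib

open scoped TensorProduct

noncomputable section

namespace LinAlgGroup

/-! ### The Zariski topology -/

section Zariski

variable {K : Type*} [Field K] {σ : Type*}

/-- The Zariski topology on the affine space `σ → K`: the closed sets are the common zero sets of
ideals of the polynomial ring `K[x_s : s ∈ σ]`. -/
abbrev zariskiTopology (K : Type*) [Field K] (σ : Type*) : TopologicalSpace (σ → K) :=
  TopologicalSpace.ofClosed
    (Set.range fun I : Ideal (MvPolynomial σ K) => MvPolynomial.zeroLocus K I)
    ⟨⊤, by simp⟩
    (by
      intro A hA
      have hA' : ∀ s : Set (σ → K), ∃ I : Ideal (MvPolynomial σ K),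
          s ∈ A → MvPolynomial.zeroLocus K I = s := by
        intro s
        by_cases hs : s ∈ A
        · obtain ⟨I, hI⟩ := hA hs
          exact ⟨I, fun _ => hI⟩
        · exact ⟨⊤, fun h => absurd h hs⟩
      choose J hJ using hA'
      refine ⟨⨆ s ∈ A, J s, ?_⟩
      apply Set.Subset.antisymm
      · intro x hx s hs
        rw [← hJ s hs]
        exact MvPolynomial.zeroLocus_anti_mono (le_biSup J hs) hx
      · intro x hx
        have h : (⨆ s ∈ A, J s) ≤ MvPolynomial.vanishingIdeal K {x} := by
          refine iSup₂_le fun s hs p hp => ?_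
          have hxs : x ∈ MvPolynomial.zeroLocus K (J s) := by
            have := hx s hs
            rwa [← hJ s hs] at this
          simpa using hxs p hp
        intro p hp
        simpa using h hp)
    (by
      rintro _ ⟨I, rfl⟩ _ ⟨J, rfl⟩
      refine ⟨I * J, ?_⟩
      apply Set.Subset.antisymm
      · intro x hx
        by_contra hc
        simp only [Set.mem_union, not_or, MvPolynomial.mem_zeroLocus_iff, not_forall] at hc
        obtain ⟨⟨p, hp, hpx⟩, q, hq, hqx⟩ := hc
        have := hx (p * q) (Ideal.mul_mem_mul hp hq)
        rw [map_mul] at this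
        exact (mul_ne_zero hpx hqx) this
      · rintro x (hx | hx)
        · exact fun p hp => hx p ((Ideal.mul_le_inf (I := I) (J := J) hp).1)
        · exact fun p hp => hx p ((Ideal.mul_le_inf (I := I) (J := J) hp).2))

/-- `V ⊆ K^σ` is (an affine variety) defined over `k`: it is Zariski closed, and the ideal of all
polynomials over `K` vanishing on `V` is generated by polynomials with coefficients in `k`. -/
def VarietyDefinedOver (k : Type*) [Field k] [Algebra k K] (V : Set (σ → K)) : Prop :=
  @IsClosed (σ → K) (zariskiTopology K σ) V ∧
    ∃ S : Set (MvPolynomial σ k),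
      MvPolynomial.vanishingIdeal K V = Ideal.span (MvPolynomial.map (algebraMap k K) '' S)

end Zariski

/-! ### Linear algebraic groups

A linear algebraic group over the algebraically closed field `K` is a Zariski closed subgroup of
`SL_n(K)`, where `n × n` matrices are regarded as points of the affine space `K^(n × n)`. -/

section Groups

variable {K : Type*} [Field K]
variable {n m : Type*} [Fintype n] [DecidableEq n] [Fintype m] [DecidableEq m]

/-- The point of `K^(n × n)` given by the entries of a matrix. -/
def entries {R : Type*} (M : Matrix n n R) : n × n → R := fun p => M p.1 p.2

/-- The subset of the affine space `K^(n × n)` underlying a subgroup of `SL_n(K)`. -/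
def points (G : Subgroup (Matrix.SpecialLinearGroup n K)) : Set (n × n → K) :=
  (fun g : Matrix.SpecialLinearGroup n K => entries (g : Matrix n n K)) '' G

/-- `G` is an algebraic group (a Zariski closed subgroup of `SL_n(K)`) defined over `k`. -/
def DefinedOver (k : Type*) [Field k] [Algebra k K]
    (G : Subgroup (Matrix.SpecialLinearGroup n K)) : Prop :=
  VarietyDefinedOver k (points G)

/-- `G` is connected in the Zariski topology. -/
def ZariskiConnected (G : Subgroup (Matrix.SpecialLinearGroup n K)) : Prop :=
  @IsConnected (n × n → K) (zariskiTopology K (n × n)) (points G)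

/-- `G` is a `k`-simple algebraic group: a connected nonabelian algebraic group defined over `k`
that has no nontrivial proper closed connected normal subgroup defined over `k`. For `k = K` this
is the notion of an (absolutely) simple algebraic group. -/
def IsSimpleOver (k : Type*) [Field k] [Algebra k K]
    (G : Subgroup (Matrix.SpecialLinearGroup n K)) : Prop :=
  DefinedOver k G ∧ ZariskiConnected G ∧ (∃ g ∈ G, ∃ h ∈ G, g * h ≠ h * g) ∧
    ∀ L : Subgroup (Matrix.SpecialLinearGroup n K),
      L ≤ G → (L.subgroupOf G).Normal → DefinedOver k L → ZariskiConnected L → L = ⊥ ∨ L = G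

/-- The map `f : G → G'` is given by the matrix `P` of polynomials over `k` in the entries. -/
def RepresentedBy {k : Type*} [Field k] [Algebra k K]
    {G : Subgroup (Matrix.SpecialLinearGroup n K)} {G' : Subgroup (Matrix.SpecialLinearGroup m K)}
    (f : G → G') (P : Matrix m m (MvPolynomial (n × n) k)) : Prop :=
  ∀ g : G, ((f g : Matrix.SpecialLinearGroup m K) : Matrix m m K) =
    P.map (MvPolynomial.aeval (entries ((g : Matrix.SpecialLinearGroup n K) : Matrix n n K)))

/-- The group isomorphism `f` is an isomorphism of algebraic groups defined over `k`: `f` and its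
inverse are given by polynomials with coefficients in `k`. -/
def IsIsomorphismOver (k : Type*) [Field k] [Algebra k K]
    {G : Subgroup (Matrix.SpecialLinearGroup n K)} {G' : Subgroup (Matrix.SpecialLinearGroup m K)}
    (f : G ≃* G') : Prop :=
  (∃ P : Matrix m m (MvPolynomial (n × n) k), RepresentedBy f P) ∧
    ∃ Q : Matrix n n (MvPolynomial (m × m) k), RepresentedBy f.symm Q

/-- `f'` is the conjugate `f^τ` of the `k`-defined map `f` under the field automorphism `τ` of `k`:
it is obtained by applying `τ` to the coefficients of polynomials defining `f`. -/
def IsConjugateBy {k : Type*} [Field k] [Algebra k K] (τ : k →+* k)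
    {G : Subgroup (Matrix.SpecialLinearGroup n K)} {G' : Subgroup (Matrix.SpecialLinearGroup m K)}
    (f f' : G → G') : Prop :=
  ∃ P : Matrix m m (MvPolynomial (n × n) k),
    RepresentedBy f P ∧ RepresentedBy f' (P.map (MvPolynomial.map τ))

/-- The embedding `SL_n × SL_m → SL_(n+m)` as block diagonal matrices. -/
def blockDiag : Matrix.SpecialLinearGroup n K × Matrix.SpecialLinearGroup m K →*
    Matrix.SpecialLinearGroup (n ⊕ m) K where
  toFun g := ⟨Matrix.fromBlocks (g.1 : Matrix n n K) 0 0 (g.2 : Matrix m m K), by simp [Matrix.det_fromBlocks_zero₂₁]⟩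
  map_one' := by
    apply Subtype.ext
    simp
  map_mul' g h := by
    apply Subtype.ext
    change Matrix.fromBlocks ((g.1 : Matrix n n K) * (h.1 : Matrix n n K)) 0 0
        ((g.2 : Matrix m m K) * (h.2 : Matrix m m K)) =
      Matrix.fromBlocks (g.1 : Matrix n n K) 0 0 (g.2 : Matrix m m K) *
        Matrix.fromBlocks (h.1 : Matrix n n K) 0 0 (h.2 : Matrix m m K)
    simp [Matrix.fromBlocks_multiply]

theorem blockDiag_injective :
    Function.Injective (blockDiag : Matrix.SpecialLinearGroup n K × Matrix.SpecialLinearGroup m K →*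
      Matrix.SpecialLinearGroup (n ⊕ m) K) := by
  rintro ⟨g₁, g₂⟩ ⟨h₁, h₂⟩ h
  have h' := congrArg Subtype.val h
  have h'' := Matrix.fromBlocks_inj.1 h'
  exact Prod.ext (Subtype.ext h''.1) (Subtype.ext h''.2.2.2)

/-- The direct product of two algebraic groups, realized by block diagonal matrices. -/
def prod (G : Subgroup (Matrix.SpecialLinearGroup n K))
    (G' : Subgroup (Matrix.SpecialLinearGroup m K)) :
    Subgroup (Matrix.SpecialLinearGroup (n ⊕ m) K) :=
  (G.prod G').map blockDiag

/-- The identification of pairs `(g, g')` with elements of `prod G G'`. -/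
def prodEquiv (G : Subgroup (Matrix.SpecialLinearGroup n K))
    (G' : Subgroup (Matrix.SpecialLinearGroup m K)) : G × G' ≃* prod G G' :=
  (G.prodEquiv G').symm.trans ((G.prod G').equivMapOfInjective blockDiag blockDiag_injective)

/-- The swap `(g, h) ↦ (h, g)` of the two factors of `G × G`. -/
def swapFactors (G : Subgroup (Matrix.SpecialLinearGroup n K)) : prod G G ≃* prod G G :=
  (prodEquiv G G).symm.trans (MulEquiv.prodComm.trans (prodEquiv G G))

end Groups

/-! ### Restriction of scalars

Let `k / k₀` be a finite extension with basis `b`, and `ρ : k → M_ι(k₀)` the regular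
representation of `k` in this basis. -/

section Restriction

variable {k₀ k : Type*} [Field k₀] [Field k] [Algebra k₀ k]
variable {ι : Type*} [Fintype ι] [DecidableEq ι]
variable (K : Type*) [Field K] [Algebra k₀ K]
variable (n : Type*) [Fintype n] [DecidableEq n]

/-- The `K`-linear extension `K ⊗ k → M_ι(K)` of the regular representation of `k`. It is injective
and its image is the `K`-span of `ρ(k)`, i.e. the set of zeros in `M_ι(K)` of the linear equations
over `k₀` which define `ρ(k)` in `M_ι(k₀)`. -/
def regularRep (b : Module.Basis ι k₀ k) : K ⊗[k₀] k →ₐ[K] Matrix ι ι K :=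
  Algebra.leftMulMatrix (b.baseChange K)

/-- Replace each entry of an `n × n` matrix over `K ⊗ k` by the `ι × ι` matrix representing it. -/
def expand (b : Module.Basis ι k₀ k) (Y : Matrix n n (K ⊗[k₀] k)) : Matrix (n × ι) (n × ι) K :=
  Matrix.comp n n ι ι K (Y.map (regularRep K b))

/-- Restriction of scalars from `k` to `k₀` of the subset of `M_n` defined by a set `S` of
polynomials with coefficients in `k`. It consists of the matrices made of `ι × ι` blocks such that
every block lies in the `K`-span of `ρ(k)`, and such that every polynomial of `S` vanishes when its
variables are replaced by the blocks and its coefficients `c` by `ρ(c)`; as `K ⊗ k` is identified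
with the `K`-span of `ρ(k)`, the latter is computed in `K ⊗ k`. -/
def restrictScalarsSet (b : Module.Basis ι k₀ k) (S : Set (MvPolynomial (n × n) k)) :
    Set (Matrix (n × ι) (n × ι) K) :=
  {Z | ∃ Y : Matrix n n (K ⊗[k₀] k),
    (∀ P ∈ S, MvPolynomial.eval₂
      (Algebra.TensorProduct.includeRight : k →ₐ[k₀] K ⊗[k₀] k).toRingHom (entries Y) P = 0) ∧
    Z = expand K n b Y}

/-- The equation `det (x_ij) - 1` of `SL_n`. -/
def slEquation (k : Type*) [Field k] : MvPolynomial (n × n) k :=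
  (Matrix.mvPolynomialX n n k).det - 1

theorem mem_restrictScalarsSet_slEquation (b : Module.Basis ι k₀ k)
    (Z : Matrix (n × ι) (n × ι) K) :
    Z ∈ restrictScalarsSet K n b {slEquation n k} ↔
      ∃ Y : Matrix n n (K ⊗[k₀] k), Y.det = 1 ∧ Z = expand K n b Y := by
  have key : ∀ Y : Matrix n n (K ⊗[k₀] k), MvPolynomial.eval₂
      (Algebra.TensorProduct.includeRight : k →ₐ[k₀] K ⊗[k₀] k).toRingHom (entries Y)
      (slEquation n k) = Y.det - 1 := by
    intro Y
    rw [← MvPolynomial.coe_eval₂Hom, slEquation, map_sub, map_one, RingHom.map_det]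
    congr 2
    exact Matrix.mvPolynomialX_map_eval₂ _ Y
  constructor
  · rintro ⟨Y, hY, rfl⟩
    refine ⟨Y, ?_, rfl⟩
    have := hY _ rfl
    rwa [key, sub_eq_zero] at this
  · rintro ⟨Y, hY, rfl⟩
    refine ⟨Y, ?_, rfl⟩
    rintro P rfl
    rw [key, hY, sub_self]

set_option linter.unusedSectionVars false in
theorem expand_one (b : Module.Basis ι k₀ k) : expand K n b 1 = 1 := by
  simp [expand, Matrix.map_one, Matrix.comp_one]

set_option linter.unusedSectionVars false in
theorem expand_mul (b : Module.Basis ι k₀ k) (X Y : Matrix n n (K ⊗[k₀] k)) :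
    expand K n b (X * Y) = expand K n b X * expand K n b Y := by
  simp only [expand, Matrix.map_mul]
  exact (Matrix.compRingEquiv n ι K).map_mul _ _

/-- All elements of the restriction of scalars of `SL_n` have determinant `1`. -/
theorem det_of_mem (b : Module.Basis ι k₀ k) {Z : Matrix (n × ι) (n × ι) K}
    (hZ : Z ∈ restrictScalarsSet K n b {slEquation n k}) : Z.det = 1 := by
  obtain ⟨Y, hY, rfl⟩ := (mem_restrictScalarsSet_slEquation K n b Z).1 hZ
  have := Matrix.det_det Y (regularRep K b).toRingHom
  rw [hY, map_one, Matrix.det_one] at this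
  exact this.symm

/-- The restriction of scalars `R_{k/k₀} SL_n`, as a subgroup of `SL_(nd)(K)`, `d = [k : k₀]`. -/
def restrictScalarsSL (b : Module.Basis ι k₀ k) :
    Subgroup (Matrix.SpecialLinearGroup (n × ι) K) where
  carrier := {g | (g : Matrix (n × ι) (n × ι) K) ∈ restrictScalarsSet K n b {slEquation n k}}
  one_mem' := by
    rw [Set.mem_ofPred_eq, mem_restrictScalarsSet_slEquation]
    exact ⟨1, by simp, by simp [expand_one]⟩
  mul_mem' := by
    intro g h hg hh
    rw [Set.mem_ofPred_eq, mem_restrictScalarsSet_slEquation] at *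
    obtain ⟨X, hX, hgX⟩ := hg
    obtain ⟨Y, hY, hhY⟩ := hh
    exact ⟨X * Y, by simp [hX, hY], by
      rw [Matrix.SpecialLinearGroup.coe_mul, hgX, hhY, expand_mul]⟩
  inv_mem' := by
    intro g hg
    rw [Set.mem_ofPred_eq, mem_restrictScalarsSet_slEquation] at *
    obtain ⟨X, hX, hgX⟩ := hg
    refine ⟨X.adjugate, by simp [Matrix.det_adjugate, hX], ?_⟩
    have h1 : (g : Matrix (n × ι) (n × ι) K) * expand K n b X.adjugate = 1 := by
      rw [hgX, ← expand_mul, Matrix.mul_adjugate, hX, one_smul, expand_one]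
    have h2 : ((g⁻¹ : Matrix.SpecialLinearGroup (n × ι) K) : Matrix (n × ι) (n × ι) K) *
        (g : Matrix (n × ι) (n × ι) K) = 1 := by
      rw [← Matrix.SpecialLinearGroup.coe_mul, inv_mul_cancel, Matrix.SpecialLinearGroup.coe_one]
    exact left_inv_eq_right_inv h2 h1

end Restriction

end LinAlgGroup

end

open scoped MatrixGroups

noncomputable section

namespace LinAlgGroup

/-! ### Zariski closed sets, connectedness and fields of definition. -/

section Zariski

variable {K : Type*} [Field K] {σ : Type*}

/-! Write `J` for the matrix of multiplication by `i`. Since `J² = -1`, the algebra `K ⊗ ℚ(i)`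
splits as `K × K`, with idempotents `e = (1 - iJ)/2` and `τ(e) = (1 + iJ)/2`. These have entries in
`ℚ(i)` and are exchanged by conjugation `τ`. Hence every element of `H` is uniquely `x e + y τ(e)`
with `x, y` in `SL₂(K)` (`pairEquiv`, `coe_pairEquiv`). A linear form over `ℚ(i)` with `e ↦ 1`,
`τ(e) ↦ 0` reads off `x`, and its conjugate reads off `y`; this makes the isomorphism with `SL₂ ×
SL₂` and its inverse polynomial over `ℚ(i)`, and shows that conjugating coefficients swaps the
factors. The first factor is a closed connected normal subgroup, so `H` is not absolutely simple.

For `ℚ`-simplicity, every matrix in `SL₂` is a product of four elementary ones, so `H` is the image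
of an affine 8-space under a polynomial map over `ℚ`. This gives connectedness, and density of the
rational points gives the field of definition. A normal subgroup `L` either lies in the product of
the two centers, so it is finite and, if connected, trivial; or it has an element with a noncentral
component, and then simplicity of `PSL₂` and perfectness of `SL₂` put a whole factor into `L`. In
the second case `L` contains a unipotent element of that factor with rational entries, whose
coordinates in `H` lie in `ℚ(i)`. If `L` is defined over `ℚ`, its `ℚ(i)`-points are stable under `τ`
(`VarietyDefinedOver.comp_mem`), so `L` also meets the other factor in a noncentral element, and `L
= H`. -/

theorem aeval_algebraMap_map {k₀ k : Type*} [CommRing k₀] [CommRing k] [Algebra k₀ k]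
    [Algebra k₀ K] [Algebra k K] [IsScalarTower k₀ k K] (d : σ → k) (f : MvPolynomial σ k₀) :
    MvPolynomial.aeval (fun s => algebraMap k K (d s)) f =
      algebraMap k K (MvPolynomial.aeval d f) :=
  MvPolynomial.aeval_algebraMap_apply K d f

theorem isClosed_zariski_iff {V : Set (σ → K)} :
    @IsClosed (σ → K) (zariskiTopology K σ) V ↔
      ∃ I : Ideal (MvPolynomial σ K), MvPolynomial.zeroLocus K I = V := by
  let := zariskiTopology K σ
  rw [← isOpen_compl_iff]
  change Vᶜᶜ ∈ Set.range _ ↔ _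
  rw [compl_compl]
  rfl

theorem isClosed_zariski_setOf_aeval_eq {J : Type*} (F G : J → MvPolynomial σ K) :
    @IsClosed (σ → K) (zariskiTopology K σ)
      {p | ∀ j, MvPolynomial.aeval p (F j) = MvPolynomial.aeval p (G j)} := by
  refine isClosed_zariski_iff.2 ⟨Ideal.span (Set.range fun j => F j - G j), ?_⟩
  ext p
  simp [MvPolynomial.zeroLocus_span, sub_eq_zero]

theorem zeroLocus_vanishingIdeal_of_isClosed {V : Set (σ → K)}
    (hV : @IsClosed (σ → K) (zariskiTopology K σ) V) :
    MvPolynomial.zeroLocus K (MvPolynomial.vanishingIdeal K V) = V := by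
  obtain ⟨I, rfl⟩ := isClosed_zariski_iff.1 hV
  exact le_antisymm (MvPolynomial.zeroLocus_anti_mono (MvPolynomial.le_vanishingIdeal_zeroLocus I))
    (MvPolynomial.zeroLocus_vanishingIdeal_le _)

theorem t1Space_zariski : @T1Space (σ → K) (zariskiTopology K σ) := by
  let := zariskiTopology K σ
  refine ⟨fun x => ?_⟩
  convert isClosed_zariski_setOf_aeval_eq (fun s => MvPolynomial.X s)
    (fun s => MvPolynomial.C (x s)) using 1
  ext p
  simp [funext_iff]

/-- A finite Zariski connected set has at most one point. -/
theorem subsingleton_of_finite_of_isConnected {V : Set (σ → K)} (hf : V.Finite)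
    (hV : @IsConnected (σ → K) (zariskiTopology K σ) V) : V.Subsingleton := by
  let := zariskiTopology K σ
  have : T1Space (σ → K) := t1Space_zariski
  by_contra h
  exact hV.isPreconnected.infinite_of_nontrivial (Set.not_subsingleton_iff.1 h) hf

/-! ### Images of affine spaces under polynomial maps. -/

section Parametrization

variable {k : Type*} [Field k] [Algebra k K] {υ : Type*}

theorem aeval_aeval_eq (P : σ → MvPolynomial υ k) (u : υ → K) (F : MvPolynomial σ K) :
    MvPolynomial.aeval (fun s => MvPolynomial.aeval u (P s)) F =
      MvPolynomial.aeval u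
        (MvPolynomial.aeval (fun s => MvPolynomial.map (algebraMap k K) (P s)) F) := by
  have h := DFunLike.congr_fun (MvPolynomial.comp_aeval
    (fun s => MvPolynomial.map (algebraMap k K) (P s)) (MvPolynomial.aeval (R := K) u)) F
  simpa [MvPolynomial.aeval_map_algebraMap] using h.symm

/-- The image of an affine space under a polynomial map is Zariski connected. -/
theorem isConnected_range_aeval [Infinite K] (P : σ → MvPolynomial υ k) :
    @IsConnected (σ → K) (zariskiTopology K σ)
      (Set.range fun (u : υ → K) s => MvPolynomial.aeval u (P s)) := by
  let := zariskiTopology K σ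
  refine ⟨Set.range_nonempty _, isPreconnected_closed_iff.2 ?_⟩
  intro t t' ht ht' hcov hne hne'
  obtain ⟨I, rfl⟩ := isClosed_zariski_iff.1 ht
  obtain ⟨J, rfl⟩ := isClosed_zariski_iff.1 ht'
  set γ : (υ → K) → (σ → K) := fun u s => MvPolynomial.aeval u (P s) with hγ
  have key : (Set.range γ ⊆ MvPolynomial.zeroLocus K I) ∨
      (Set.range γ ⊆ MvPolynomial.zeroLocus K J) := by
    by_contra! h
    obtain ⟨⟨_, ⟨u, rfl⟩, hu⟩, _, ⟨v, rfl⟩, hv⟩ :=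
      And.intro (Set.not_subset.1 h.1) (Set.not_subset.1 h.2)
    simp only [MvPolynomial.mem_zeroLocus_iff, not_forall] at hu hv
    obtain ⟨⟨F, hF, hFu⟩, G, hG, hGv⟩ := And.intro hu hv
    rw [hγ, aeval_aeval_eq] at hFu hGv
    set F' := MvPolynomial.aeval (fun s => MvPolynomial.map (algebraMap k K) (P s)) F
    set G' := MvPolynomial.aeval (fun s => MvPolynomial.map (algebraMap k K) (P s)) G
    have hF' : F' ≠ 0 := fun h0 => hFu (by rw [h0, map_zero])
    have hG' : G' ≠ 0 := fun h0 => hGv (by rw [h0, map_zero])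
    -- Each parameter lands in one of the two closed sets, so the product of the pullbacks vanishes
    -- at every point; over an infinite field it is then the zero polynomial.
    refine mul_ne_zero hF' hG' (MvPolynomial.funext fun w => ?_)
    rw [map_zero, map_mul, ← MvPolynomial.coe_aeval_eq_eval]
    rcases hcov ⟨w, rfl⟩ with hw | hw
    · have := hw F hF
      rw [hγ, aeval_aeval_eq] at this
      exact mul_eq_zero_of_left this _
    · have := hw G hG
      rw [hγ, aeval_aeval_eq] at this
      exact mul_eq_zero_of_right _ this
  rcases key with h | h
  · obtain ⟨x, hx, hx'⟩ := hne'
    exact ⟨x, hx, h hx, hx'⟩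
  · obtain ⟨x, hx, hx'⟩ := hne
    exact ⟨x, hx, hx', h hx⟩

/-- A `k`-basis of `K` spans `K[x]` over `k[x]`. This splits a polynomial over `K` into components
over `k`. -/
theorem exists_eq_sum_C_mul_map {J : Type*} (B : Module.Basis J k K) (F : MvPolynomial σ K) :
    ∃ c : J →₀ MvPolynomial σ k,
      F = c.sum fun j f => MvPolynomial.C (B j) * MvPolynomial.map (algebraMap k K) f := by
  induction F using MvPolynomial.induction_on' with
  | monomial m a =>
    refine ⟨(B.repr a).mapRange (MvPolynomial.monomial m) (map_zero _), ?_⟩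
    rw [Finsupp.sum_mapRange_index (by simp)]
    conv_lhs => rw [← B.linearCombination_repr a, Finsupp.linearCombination_apply]
    simp only [Finsupp.sum, map_sum, MvPolynomial.map_monomial, MvPolynomial.C_mul_monomial,
      Algebra.smul_def, mul_comm]
  | add p q hp hq =>
    obtain ⟨c, hc⟩ := hp
    obtain ⟨d, hd⟩ := hq
    exact ⟨c + d, by
      rw [Finsupp.sum_add_index' (by simp) (by simp [mul_add]), ← hc, ← hd]⟩

/-- If the `k`-rational points are dense in a set, then its vanishing ideal is generated by
polynomials over `k`. -/
theorem vanishingIdeal_eq_span_of_dense {V : Set (σ → K)} {D : Set (σ → k)}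
    (hD : ∀ d ∈ D, (fun s => algebraMap k K (d s)) ∈ V)
    (hdense : ∀ F : MvPolynomial σ K,
      (∀ d ∈ D, MvPolynomial.aeval (fun s => algebraMap k K (d s)) F = 0) →
        F ∈ MvPolynomial.vanishingIdeal K V) :
    MvPolynomial.vanishingIdeal K V =
      Ideal.span (MvPolynomial.map (algebraMap k K) ''
        {f | MvPolynomial.map (algebraMap k K) f ∈ MvPolynomial.vanishingIdeal K V}) := by
  apply le_antisymm
  · intro F hF
    let B := Module.Basis.ofVectorSpace k K
    obtain ⟨c, rfl⟩ := exists_eq_sum_C_mul_map B F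
    refine Ideal.sum_mem _ fun j _ => Ideal.mul_mem_left _ _ (Ideal.subset_span ⟨c j, ?_, rfl⟩)
    refine hdense _ fun d hd => ?_
    have h := hF _ (hD d hd)
    -- At a `k`-rational point the components take values in `k`, so linear independence of the
    -- basis forces each of them to vanish separately.
    have hli := linearIndependent_iff.1 B.linearIndependent
      (c.mapRange (MvPolynomial.aeval d) (map_zero _)) (by
        rw [Finsupp.linearCombination_apply, Finsupp.sum_mapRange_index (by simp), ← h,
          Finsupp.sum, Finsupp.sum, map_sum]
        refine Finset.sum_congr rfl fun j _ => ?_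
        rw [map_mul, MvPolynomial.aeval_C, MvPolynomial.aeval_map_algebraMap,
          aeval_algebraMap_map, Algebra.smul_def, mul_comm, Algebra.algebraMap_self_apply])
    rw [MvPolynomial.aeval_map_algebraMap, aeval_algebraMap_map]
    have := DFunLike.congr_fun hli j
    rw [Finsupp.mapRange_apply, Finsupp.zero_apply] at this
    rw [this, map_zero]
  · rw [Ideal.span_le]
    rintro _ ⟨f, hf, rfl⟩
    exact hf

/-- A closed set with a polynomial parametrization over `k` is defined over `k`. -/
theorem varietyDefinedOver_range_aeval [Infinite k] (P : σ → MvPolynomial υ k)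
    (hcl : @IsClosed (σ → K) (zariskiTopology K σ)
      (Set.range fun (u : υ → K) s => MvPolynomial.aeval u (P s))) :
    VarietyDefinedOver k (Set.range fun (u : υ → K) s => MvPolynomial.aeval u (P s)) := by
  refine ⟨hcl, _, vanishingIdeal_eq_span_of_dense
    (D := Set.range fun (u : υ → k) s => MvPolynomial.aeval u (P s)) ?_ ?_⟩
  · rintro _ ⟨u, rfl⟩
    refine ⟨fun j => algebraMap k K (u j), funext fun s => ?_⟩
    exact aeval_algebraMap_map u (P s)
  · rintro F hF
    have : Infinite K := Infinite.of_injective _ (algebraMap k K).injective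
    -- The pullback to the parameter space vanishes at all `k`-points, an infinite grid, hence
    -- identically.
    have h0 : MvPolynomial.aeval (fun s => MvPolynomial.map (algebraMap k K) (P s)) F = 0 := by
      refine MvPolynomial.funext_set (fun _ => Set.range (algebraMap k K))
        (fun _ => Set.infinite_range_of_injective (algebraMap k K).injective) fun w hw => ?_
      choose u hu using fun j => hw j (Set.mem_univ j)
      have h1 := hF _ ⟨u, rfl⟩
      obtain rfl : (fun j => algebraMap k K (u j)) = w := funext hu
      simp only [← aeval_algebraMap_map] at h1
      rw [aeval_aeval_eq] at h1
      rw [map_zero, ← MvPolynomial.coe_aeval_eq_eval]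
      exact h1
    rintro _ ⟨u, rfl⟩
    rw [aeval_aeval_eq, h0, map_zero]

end Parametrization

/-- The `k`-points of a variety defined over `k₀` are stable under automorphisms of `k / k₀`. -/
theorem VarietyDefinedOver.comp_mem {k₀ k : Type*} [Field k₀] [Field k] [Algebra k₀ k]
    [Algebra k₀ K] [Algebra k K] [IsScalarTower k₀ k K] {V : Set (σ → K)}
    (hV : VarietyDefinedOver k₀ V) (τ : k →ₐ[k₀] k) {q : σ → k}
    (hq : (fun s => algebraMap k K (q s)) ∈ V) : (fun s => algebraMap k K (τ (q s))) ∈ V := by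
  obtain ⟨hcl, S, hS⟩ := hV
  rw [← zeroLocus_vanishingIdeal_of_isClosed hcl, hS, MvPolynomial.zeroLocus_span] at hq ⊢
  rintro _ ⟨f, hf, rfl⟩
  have h := hq _ ⟨f, hf, rfl⟩
  rw [MvPolynomial.aeval_map_algebraMap, aeval_algebraMap_map,
    map_eq_zero_iff _ (algebraMap k K).injective] at h
  -- The coefficients of `f` lie in `k₀`, so evaluating `f` commutes with `τ`.
  have h2 : MvPolynomial.aeval (fun s => τ (q s)) f = 0 := by
    have := DFunLike.congr_fun (MvPolynomial.comp_aeval q τ) f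
    rw [AlgHom.comp_apply, h, map_zero] at this
    exact this.symm
  rw [MvPolynomial.aeval_map_algebraMap, aeval_algebraMap_map, h2, map_zero]

end Zariski

/-! ### Normal subgroups of `SL₂` and `SL₂ × SL₂`; elementary factorization. -/

section SL2

variable {F : Type*} [Field F]

/-- A normal subgroup of `SL₂` over a field with an element `a ∉ {0, 1, -1}` is central or
everything. -/
theorem eq_top_of_normal_of_not_le_center (hF : ∃ a : F, a ≠ 0 ∧ a ^ 2 ≠ 1)
    (N : Subgroup SL(2, F)) [hN : N.Normal] (h : ¬ N ≤ Subgroup.center SL(2, F)) : N = ⊤ := by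
  have := Matrix.ProjectiveSpecialLinearGroup.rank_two_simple' hF
  obtain ⟨a, ha, ha2⟩ := hF
  have hmap := (hN.map (QuotientGroup.mk' (Subgroup.center SL(2, F)))
    (QuotientGroup.mk'_surjective _)).eq_bot_or_eq_top
  have hmap' : N.map (QuotientGroup.mk' (Subgroup.center SL(2, F))) = ⊤ := by
    refine hmap.resolve_left fun hb => h ?_
    rwa [Subgroup.map_eq_bot_iff, QuotientGroup.ker_mk'] at hb
  have hfac : ∀ g : SL(2, F), ∃ n ∈ N, ∃ z ∈ Subgroup.center SL(2, F), g = n * z := by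
    intro g
    obtain ⟨n, hn, hng⟩ := hmap'.ge (Subgroup.mem_top (QuotientGroup.mk' _ g))
    exact ⟨n, hn, n⁻¹ * g, QuotientGroup.eq.1 hng, by group⟩
  -- By simplicity of `PSL₂`, `N` and the center together generate `SL₂`. Central factors cancel in
  -- commutators, so all commutators lie in `N`, and `SL₂` is perfect.
  rw [eq_top_iff, ← Matrix.SL2.commutator_eq_top ha ha2, commutator_def,
    Subgroup.commutator_le]
  intro g _ g' _
  obtain ⟨n, hn, z, hz, rfl⟩ := hfac g
  obtain ⟨n', hn', z', hz', rfl⟩ := hfac g'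
  rw [Subgroup.mem_center_iff] at hz hz'
  have h₁ : n * z * (n' * z') = n * n' * (z * z') := by
    rw [mul_assoc, ← mul_assoc z, ← hz n']
    simp only [mul_assoc]
  have h₂ : n' * z' * (n * z) = n' * n * (z * z') := by
    rw [mul_assoc, ← mul_assoc z', ← hz' n, hz' z, mul_assoc n]
    simp only [mul_assoc]
  have h₃ : n * z * (n' * z') * (n' * z' * (n * z))⁻¹ = n * n' * (n' * n)⁻¹ := by
    rw [h₁, h₂]
    group
  rw [commutatorElement_def, mul_assoc, ← mul_inv_rev, h₃]
  exact N.mul_mem (N.mul_mem hn hn') (N.inv_mem (N.mul_mem hn' hn))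

/-- A normal subgroup of `SL₂ × SL₂` whose first projection is not central contains the first
factor. -/
theorem mk_one_mem_of_normal (hF : ∃ a : F, a ≠ 0 ∧ a ^ 2 ≠ 1)
    (L : Subgroup (SL(2, F) × SL(2, F))) [hL : L.Normal] {x y : SL(2, F)} (hxy : (x, y) ∈ L)
    (hx : x ∉ Subgroup.center SL(2, F)) (g : SL(2, F)) : (g, 1) ∈ L := by
  have hp : L.map (MonoidHom.fst _ _) = ⊤ := by
    have := hL.map (MonoidHom.fst SL(2, F) SL(2, F)) Prod.fst_surjective
    exact eq_top_of_normal_of_not_le_center hF _ fun h => hx (h ⟨_, hxy, rfl⟩)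
  have htop : L.comap (MonoidHom.inl _ _) = ⊤ := by
    obtain ⟨a, ha, ha2⟩ := hF
    rw [eq_top_iff, ← Matrix.SL2.commutator_eq_top ha ha2, commutator_def,
      Subgroup.commutator_le]
    intro u _ v _
    obtain ⟨⟨u, w⟩, huw, rfl⟩ := hp.ge (Subgroup.mem_top u)
    -- The commutator of `(u, w)` with `(v, 1)` is `([u, v], 1)`, whatever `w` is.
    have := L.mul_mem huw (hL.conj_mem _ (L.inv_mem huw) (v, 1))
    simpa [commutatorElement_def, mul_assoc] using this
  exact htop.ge (Subgroup.mem_top g)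

theorem one_mk_mem_of_normal (hF : ∃ a : F, a ≠ 0 ∧ a ^ 2 ≠ 1)
    (L : Subgroup (SL(2, F) × SL(2, F))) [hL : L.Normal] {x y : SL(2, F)} (hxy : (x, y) ∈ L)
    (hy : y ∉ Subgroup.center SL(2, F)) (g : SL(2, F)) : (1, g) ∈ L := by
  have := hL.comap (MulEquiv.prodComm (M := SL(2, F)) (N := SL(2, F))).toMonoidHom
  exact mk_one_mem_of_normal hF (L.comap (MulEquiv.prodComm (M := SL(2, F))
    (N := SL(2, F))).toMonoidHom) (x := y) (y := x) hxy hy g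

/-- A product of four elementary `2 × 2` matrices. -/
def fourElementary {R : Type*} [Ring R] (u : Fin 4 → R) : Matrix (Fin 2) (Fin 2) R :=
  !![1, 0; u 0, 1] * !![1, u 1; 0, 1] * !![1, 0; u 2, 1] * !![1, u 3; 0, 1]

theorem fourElementary_map {R S : Type*} [Ring R] [Ring S] (f : R →+* S) (u : Fin 4 → R) :
    (fourElementary u).map f = fourElementary fun j => f (u j) := by
  ext i j
  fin_cases i <;> fin_cases j <;> simp [fourElementary]

theorem det_fourElementary {R : Type*} [CommRing R] (u : Fin 4 → R) :
    (fourElementary u).det = 1 := by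
  simp only [fourElementary, Matrix.det_mul, Matrix.det_fin_two_of]
  ring

theorem exists_eq_fourElementary (g : SL(2, F)) :
    ∃ u : Fin 4 → F, (g : Matrix (Fin 2) (Fin 2) F) = fourElementary u := by
  have hd := g.det_coe
  rw [Matrix.det_fin_two] at hd
  obtain ⟨s, hs⟩ : ∃ s : F, g 1 0 + s * g 0 0 ≠ 0 := by
    by_cases h : g 1 0 = 0
    · refine ⟨1, fun h' => ?_⟩
      rw [h, one_mul, zero_add] at h'
      simp [h, h'] at hd
    · exact ⟨0, by simpa using h⟩
  set c := g 1 0 + s * g 0 0 with hc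
  -- Adding `s` times the first row to the second makes the lower left entry `c` nonzero. A matrix
  -- of determinant `1` with such an entry is upper times lower times upper; the diagonal entries
  -- give the two quotients, and the determinant forces the remaining entry.
  refine ⟨![-s, (g 0 0 - 1) / c, c, (g 1 1 + s * g 0 1 - 1) / c], ?_⟩
  ext i j
  fin_cases i <;> fin_cases j <;>
    simp [fourElementary] <;> field_simp <;> grind

end SL2

/-! ### Conjugation on `ℚ(i)`, the idempotents and the recovering linear form. -/

section GaussianField

variable {K : Type*} [Field K] [CharZero K] {i : K}

open IntermediateField AdjoinSimple

theorem gen_mul_gen (hi : i ^ 2 = -1) : gen ℚ i * gen ℚ i = -1 := by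
  apply Subtype.ext
  simpa [sq] using hi

theorem exists_eq_add_mul_gen (hi : i ^ 2 = -1) (c : adjoin ℚ {i}) :
    ∃ p q : ℚ, c = algebraMap ℚ _ p + algebraMap ℚ _ q * gen ℚ i := by
  have hint : IsIntegral ℚ i := ⟨Polynomial.X ^ 2 + 1, by monicity!, by simp [hi]⟩
  have h : (c : K) ∈ Algebra.adjoin ℚ {i} := by
    rw [← adjoin_simple_toSubalgebra_of_isAlgebraic hint.isAlgebraic]
    exact c.2
  suffices ∀ x ∈ Algebra.adjoin ℚ {i}, ∃ p q : ℚ, x = algebraMap ℚ K p + algebraMap ℚ K q * i by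
    obtain ⟨p, q, h⟩ := this _ h
    exact ⟨p, q, Subtype.ext (by simpa using h)⟩
  intro x hx
  induction hx using Algebra.adjoin_induction with
  | mem x hx => exact ⟨0, 1, by simpa using hx⟩
  | algebraMap r => exact ⟨r, 0, by simp⟩
  | add x y _ _ hx hy =>
    obtain ⟨p, q, rfl⟩ := hx
    obtain ⟨p', q', rfl⟩ := hy
    exact ⟨p + p', q + q', by simp only [map_add]; ring⟩
  | mul x y _ _ hx hy =>
    obtain ⟨p, q, rfl⟩ := hx
    obtain ⟨p', q', rfl⟩ := hy
    refine ⟨p * p' - q * q', p * q' + q * p', ?_⟩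
    simp only [map_add, map_sub, map_mul]
    linear_combination (algebraMap ℚ K q * algebraMap ℚ K q') * hi

theorem exists_conj (hi : i ^ 2 = -1) :
    ∃ τ : adjoin ℚ {i} ≃ₐ[ℚ] adjoin ℚ {i}, τ (gen ℚ i) = -gen ℚ i := by
  have hint : IsIntegral ℚ i := ⟨Polynomial.X ^ 2 + 1, by monicity!, by simp [hi]⟩
  have hmin : minpoly ℚ i = Polynomial.X ^ 2 + 1 := by
    symm
    refine minpoly.eq_of_irreducible_of_monic ?_ (by simp [hi]) (by monicity!)
    rw [Polynomial.irreducible_iff_roots_eq_zero_of_degree_le_three]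
    · rw [Multiset.eq_zero_iff_forall_notMem]
      intro a ha
      have := Polynomial.isRoot_of_mem_roots ha
      simp only [Polynomial.IsRoot.def, Polynomial.eval_add, Polynomial.eval_pow,
        Polynomial.eval_X, Polynomial.eval_one] at this
      nlinarith
    · exact (show (Polynomial.X ^ 2 + 1 : Polynomial ℚ).natDegree = 2 by compute_degree!).ge
    · exact (show (Polynomial.X ^ 2 + 1 : Polynomial ℚ).natDegree = 2 by compute_degree!).le.trans
        (by norm_num)
  have hneg : (minpoly ℚ i).aeval (-gen ℚ i) = 0 := by
    rw [hmin]
    simp [sq, gen_mul_gen hi]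
  let τ : adjoin ℚ {i} →ₐ[ℚ] adjoin ℚ {i} :=
    (adjoin.powerBasis hint).lift (-gen ℚ i) (by rwa [adjoin.powerBasis_gen, minpoly_gen])
  have hτ : τ (gen ℚ i) = -gen ℚ i := by
    rw [← adjoin.powerBasis_gen hint]
    exact ((adjoin.powerBasis hint).lift_gen _ _).trans
      (congrArg Neg.neg (adjoin.powerBasis_gen hint).symm)
  have hττ : τ.comp τ = AlgHom.id ℚ _ := by
    ext c
    obtain ⟨p, q, rfl⟩ := exists_eq_add_mul_gen hi c
    simp [hτ]
  exact ⟨AlgEquiv.ofAlgHom τ τ hττ hττ, hτ⟩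

theorem conj_conj (hi : i ^ 2 = -1) {τ : adjoin ℚ {i} ≃ₐ[ℚ] adjoin ℚ {i}}
    (hτ : τ (gen ℚ i) = -gen ℚ i) (c : adjoin ℚ {i}) : τ (τ c) = c := by
  obtain ⟨p, q, rfl⟩ := exists_eq_add_mul_gen hi c
  simp [hτ]

/-- The homomorphism `K × K → A` sending `(i, -i)` to a square root `j` of `-1`. -/
def splitHom (hi : i ^ 2 = -1) {A : Type*} [CommRing A] [Algebra K A] (j : A) (hj : j * j = -1) :
    K × K →ₐ[K] A where
  -- The image is `α + βj`, where `α + βi = x.1` and `α - βi = x.2`; thus `β = (x.1 - x.2)/(2i) =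
  -- -i(x.1 - x.2)/2`.
  toFun x := algebraMap K A ((x.1 + x.2) / 2) - algebraMap K A (i * (x.1 - x.2) / 2) * j
  map_one' := by simp
  map_zero' := by simp
  map_add' x y := by
    rw [show ((x + y).1 + (x + y).2) / 2 = (x.1 + x.2) / 2 + (y.1 + y.2) / 2 by simp; ring,
      show i * ((x + y).1 - (x + y).2) / 2 = i * (x.1 - x.2) / 2 + i * (y.1 - y.2) / 2 by
        simp; ring, map_add, map_add]
    ring
  map_mul' x y := by
    rw [show ((x * y).1 + (x * y).2) / 2 = (x.1 + x.2) / 2 * ((y.1 + y.2) / 2) -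
        i * (x.1 - x.2) / 2 * (i * (y.1 - y.2) / 2) by
          simp; linear_combination ((x.1 - x.2) * (y.1 - y.2) / 4) * hi,
      show i * ((x * y).1 - (x * y).2) / 2 = (x.1 + x.2) / 2 * (i * (y.1 - y.2) / 2) +
        i * (x.1 - x.2) / 2 * ((y.1 + y.2) / 2) by simp; ring]
    rw [map_sub, map_add, map_mul (algebraMap K A) (_ / 2), map_mul (algebraMap K A) (_ / 2),
      map_mul (algebraMap K A) (_ / 2), map_mul (algebraMap K A) (_ / 2)]
    linear_combination (-algebraMap K A (i * (x.1 - x.2) / 2) *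
      algebraMap K A (i * (y.1 - y.2) / 2)) * hj
  commutes' r := by simp [← two_mul]

theorem splitHom_apply (hi : i ^ 2 = -1) {A : Type*} [CommRing A] [Algebra K A] (j : A)
    (hj : j * j = -1) (x : K × K) : splitHom hi j hj x =
      algebraMap K A ((x.1 + x.2) / 2) - algebraMap K A (i * (x.1 - x.2) / 2) * j := rfl

variable {ι : Type*} [Fintype ι] [DecidableEq ι] (b : Module.Basis ι ℚ (adjoin ℚ {i}))

/-- The matrix of multiplication by `i`. -/
def genMatrix : Matrix ι ι ℚ := Algebra.leftMulMatrix b (gen ℚ i)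

theorem regularRep_one_tmul (c : adjoin ℚ {i}) :
    regularRep K b (1 ⊗ₜ c) = (Algebra.leftMulMatrix b c).map (algebraMap ℚ K) := by
  ext l m
  rw [regularRep, Algebra.leftMulMatrix_eq_repr_mul, Matrix.map_apply,
    Algebra.leftMulMatrix_eq_repr_mul, Module.Basis.baseChange_apply,
    Algebra.TensorProduct.tmul_mul_tmul, one_mul, Module.Basis.baseChange_repr_tmul]
  rw [Algebra.smul_def, mul_one]

theorem regularRep_injective : Function.Injective (regularRep K b) :=
  Algebra.leftMulMatrix_injective _

/-- The entries of the matrix of the idempotent `(1, 0)` of `K × K ≅ K ⊗ ℚ(i)`. -/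
def idemMatrix : Matrix ι ι (adjoin ℚ {i}) :=
  Matrix.of fun l m => ((1 : Matrix ι ι (adjoin ℚ {i})) l m -
    gen ℚ i * algebraMap ℚ _ (genMatrix b l m)) / 2

/-- The coefficients of a linear form on `M_ι(ℚ(i))` which maps the matrix of each `c ∈ ℚ(i)`
to `c`. -/
def recoverMatrix : Matrix ι ι (adjoin ℚ {i}) :=
  Matrix.of fun l m => b l * algebraMap ℚ _ (b.repr 1 m)

/-- The matrix of `c` applied to the coordinates of `1` gives the coordinates of `c`; summing these
against the basis returns `c`. -/
theorem sum_recoverMatrix_mul (c : adjoin ℚ {i}) :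
    ∑ l, ∑ m, recoverMatrix b l m * algebraMap ℚ _ (Algebra.leftMulMatrix b c l m) = c := by
  have h : ∀ m, ∑ l, b l * algebraMap ℚ _ (Algebra.leftMulMatrix b c l m) = c * b m := by
    intro m
    conv_rhs => rw [← b.sum_repr (c * b m)]
    refine Finset.sum_congr rfl fun l _ => ?_
    rw [Algebra.leftMulMatrix_eq_repr_mul, Algebra.smul_def, mul_comm]
  rw [Finset.sum_comm]
  calc _ = ∑ m, algebraMap ℚ _ (b.repr 1 m) * (c * b m) := by
        refine Finset.sum_congr rfl fun m _ => ?_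
        rw [← h, Finset.mul_sum]
        exact Finset.sum_congr rfl fun l _ => by simp [recoverMatrix]; ring
    _ = c * ∑ m, b.repr 1 m • b m := by
        rw [Finset.mul_sum]
        exact Finset.sum_congr rfl fun m _ => by rw [Algebra.smul_def]; ring
    _ = c := by rw [b.sum_repr, mul_one]

/-- The form sends the matrices of `1` and `i` to `1` and `i`, so by `ℚ(i)`-linearity `(1 - iJ)/2`
goes to `(1 - i²)/2 = 1`. For the conjugate idempotent the value is `(1 + i²)/2 = 0`. -/
theorem sum_recoverMatrix_mul_idemMatrix (hi : i ^ 2 = -1) :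
    ∑ l, ∑ m, recoverMatrix b l m * idemMatrix b l m = 1 := by
  have h1 := sum_recoverMatrix_mul b 1
  have h2 := sum_recoverMatrix_mul b (gen ℚ i)
  have : ∑ l, ∑ m, recoverMatrix b l m * idemMatrix b l m =
      (∑ l, ∑ m, recoverMatrix b l m * algebraMap ℚ _ (Algebra.leftMulMatrix b 1 l m) -
        gen ℚ i * ∑ l, ∑ m, recoverMatrix b l m *
          algebraMap ℚ _ (Algebra.leftMulMatrix b (gen ℚ i) l m)) / 2 := by
    rw [Finset.mul_sum, ← Finset.sum_sub_distrib, Finset.sum_div]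
    refine Finset.sum_congr rfl fun l _ => ?_
    rw [Finset.mul_sum, ← Finset.sum_sub_distrib, Finset.sum_div]
    refine Finset.sum_congr rfl fun m _ => ?_
    simp [idemMatrix, genMatrix, Matrix.one_apply]
    split_ifs <;> ring
  rw [this, h1, h2, gen_mul_gen hi]
  norm_num

theorem conj_idemMatrix {τ : adjoin ℚ {i} ≃ₐ[ℚ] adjoin ℚ {i}} (hτ : τ (gen ℚ i) = -gen ℚ i)
    (l m : ι) : τ (idemMatrix b l m) = ((1 : Matrix ι ι (adjoin ℚ {i})) l m +
      gen ℚ i * algebraMap ℚ _ (genMatrix b l m)) / 2 := by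
  have h1 : τ ((1 : Matrix ι ι (adjoin ℚ {i})) l m) = (1 : Matrix ι ι (adjoin ℚ {i})) l m := by
    rw [Matrix.one_apply]
    split_ifs <;> simp
  have h2 : τ 2 = 2 := map_ofNat τ 2
  rw [idemMatrix, Matrix.of_apply, map_div₀, map_sub, map_mul, hτ, AlgEquiv.commutes, h1, h2]
  ring

theorem sum_recoverMatrix_mul_conj_idemMatrix (hi : i ^ 2 = -1)
    {τ : adjoin ℚ {i} ≃ₐ[ℚ] adjoin ℚ {i}} (hτ : τ (gen ℚ i) = -gen ℚ i) :
    ∑ l, ∑ m, recoverMatrix b l m * τ (idemMatrix b l m) = 0 := by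
  have h1 := sum_recoverMatrix_mul b 1
  have h2 := sum_recoverMatrix_mul b (gen ℚ i)
  have : ∑ l, ∑ m, recoverMatrix b l m * τ (idemMatrix b l m) =
      (∑ l, ∑ m, recoverMatrix b l m * algebraMap ℚ _ (Algebra.leftMulMatrix b 1 l m) +
        gen ℚ i * ∑ l, ∑ m, recoverMatrix b l m *
          algebraMap ℚ _ (Algebra.leftMulMatrix b (gen ℚ i) l m)) / 2 := by
    rw [Finset.mul_sum, ← Finset.sum_add_distrib, Finset.sum_div]
    refine Finset.sum_congr rfl fun l _ => ?_
    rw [Finset.mul_sum, ← Finset.sum_add_distrib, Finset.sum_div]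
    refine Finset.sum_congr rfl fun m _ => ?_
    rw [conj_idemMatrix b hτ]
    simp [genMatrix, Matrix.one_apply]
    split_ifs <;> ring
  rw [this, h1, h2, gen_mul_gen hi]
  norm_num

end GaussianField

/-! ### The splitting `K ⊗ ℚ(i) ≅ K × K` and its effect on `SL_n`. -/

section Splitting

open IntermediateField AdjoinSimple

variable {K : Type*} [Field K] [CharZero K] {i : K} (hi : i ^ 2 = -1)
variable {ι : Type*} [Fintype ι] [DecidableEq ι] (b : Module.Basis ι ℚ (adjoin ℚ {i}))
variable {τ : adjoin ℚ {i} ≃ₐ[ℚ] adjoin ℚ {i}} (hτ : τ (gen ℚ i) = -gen ℚ i)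

include hi in
theorem one_tmul_gen_mul_self :
    ((1 : K) ⊗ₜ[ℚ] gen ℚ i) * ((1 : K) ⊗ₜ[ℚ] gen ℚ i) = -1 := by
  rw [Algebra.TensorProduct.tmul_mul_tmul, gen_mul_gen hi, mul_one, TensorProduct.tmul_neg]
  rfl

/-- The `2 × 2` block matrix with blocks `x_st e + y_st τ(e)`, where `e` and `τ(e)` are the
matrices of the two primitive idempotents of `K ⊗ ℚ(i)`. -/
def pairMatrix (τ : adjoin ℚ {i} ≃ₐ[ℚ] adjoin ℚ {i}) {n : Type*} (x y : Matrix n n K) :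
    Matrix (n × ι) (n × ι) K :=
  Matrix.of fun p q => x p.1 q.1 * algebraMap _ K (idemMatrix b p.2 q.2) +
    y p.1 q.1 * algebraMap _ K (τ (idemMatrix b p.2 q.2))

include hτ in
theorem regularRep_splitHom (x : K × K) (l m : ι) :
    regularRep K b (splitHom hi (1 ⊗ₜ gen ℚ i) (one_tmul_gen_mul_self hi) x) l m =
      x.1 * algebraMap _ K (idemMatrix b l m) + x.2 * algebraMap _ K (τ (idemMatrix b l m)) := by
  rw [splitHom_apply, map_sub, map_mul, AlgHom.commutes, AlgHom.commutes, regularRep_one_tmul,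
    conj_idemMatrix b hτ, idemMatrix, Matrix.of_apply]
  have hone : algebraMap (adjoin ℚ {i}) K ((1 : Matrix ι ι (adjoin ℚ {i})) l m) =
      (1 : Matrix ι ι K) l m := by
    rw [Matrix.one_apply, Matrix.one_apply]
    split_ifs <;> simp
  have h2 : algebraMap (adjoin ℚ {i}) K 2 = 2 := map_ofNat _ 2
  rw [map_div₀ (algebraMap (adjoin ℚ {i}) K), map_div₀ (algebraMap (adjoin ℚ {i}) K),
    map_add (algebraMap (adjoin ℚ {i}) K), map_sub (algebraMap (adjoin ℚ {i}) K),
    map_mul (algebraMap (adjoin ℚ {i}) K), hone, h2, AdjoinSimple.algebraMap_gen,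
    ← IsScalarTower.algebraMap_apply, Matrix.sub_apply, Algebra.algebraMap_eq_smul_one,
    Algebra.algebraMap_eq_smul_one, Matrix.smul_apply, smul_mul_assoc, one_mul, Matrix.smul_apply,
    Matrix.map_apply, smul_eq_mul, smul_eq_mul, genMatrix]
  ring

include hi hτ in
theorem sum_recover_fst (x y : K) :
    ∑ l, ∑ m, algebraMap _ K (recoverMatrix b l m) * (x * algebraMap _ K (idemMatrix b l m) +
      y * algebraMap _ K (τ (idemMatrix b l m))) = x := by
  have h1 := congrArg (algebraMap _ K) (sum_recoverMatrix_mul_idemMatrix b hi)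
  have h2 := congrArg (algebraMap _ K) (sum_recoverMatrix_mul_conj_idemMatrix b hi hτ)
  simp only [map_sum, map_mul, map_one, map_zero] at h1 h2
  calc _ = x * (∑ l, ∑ m, algebraMap _ K (recoverMatrix b l m) * algebraMap _ K (idemMatrix b l m))
        + y * ∑ l, ∑ m, algebraMap _ K (recoverMatrix b l m) *
          algebraMap _ K (τ (idemMatrix b l m)) := by
        simp only [Finset.mul_sum, ← Finset.sum_add_distrib]
        exact Finset.sum_congr rfl fun l _ => Finset.sum_congr rfl fun m _ => by ring
    _ = x := by rw [h1, h2]; ring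

include hi hτ in
theorem sum_recover_snd (x y : K) :
    ∑ l, ∑ m, algebraMap _ K (τ (recoverMatrix b l m)) * (x * algebraMap _ K (idemMatrix b l m) +
      y * algebraMap _ K (τ (idemMatrix b l m))) = y := by
  -- Applying `τ` to the two identities for the form, with `τ² = 1`, shows that the conjugate form
  -- sends `τ(e)` to `1` and `e` to `0`.
  have h1 := congrArg (fun c => algebraMap _ K (τ c)) (sum_recoverMatrix_mul_idemMatrix b hi)
  have h2 := congrArg (fun c => algebraMap _ K (τ c))
    (sum_recoverMatrix_mul_conj_idemMatrix b hi hτ)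
  simp only [map_sum, map_mul, map_one, map_zero, conj_conj hi hτ] at h1 h2
  calc _ = y * (∑ l, ∑ m, algebraMap _ K (τ (recoverMatrix b l m)) *
          algebraMap _ K (τ (idemMatrix b l m)))
        + x * ∑ l, ∑ m, algebraMap _ K (τ (recoverMatrix b l m)) *
          algebraMap _ K (idemMatrix b l m) := by
        simp only [Finset.mul_sum, ← Finset.sum_add_distrib]
        exact Finset.sum_congr rfl fun l _ => Finset.sum_congr rfl fun m _ => by ring
    _ = y := by rw [h1, h2]; ring

theorem splitHom_bijective :
    Function.Bijective (splitHom hi ((1 : K) ⊗ₜ[ℚ] gen ℚ i) (one_tmul_gen_mul_self hi)) := by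
  obtain ⟨τ, hτ⟩ := exists_conj hi
  have hint : IsIntegral ℚ i := ⟨Polynomial.X ^ 2 + 1, by monicity!, by simp [hi]⟩
  -- The claim involves no basis; an auxiliary one makes the recovering forms available for
  -- injectivity.
  let b := (adjoin.powerBasis hint).basis
  constructor
  · intro x y hxy
    have h : ∀ l m, x.1 * algebraMap _ K (idemMatrix b l m) +
        x.2 * algebraMap _ K (τ (idemMatrix b l m)) = y.1 * algebraMap _ K (idemMatrix b l m) +
        y.2 * algebraMap _ K (τ (idemMatrix b l m)) := by
      intro l m
      rw [← regularRep_splitHom hi b hτ, hxy, regularRep_splitHom hi b hτ]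
    ext
    · rw [← sum_recover_fst hi b hτ x.1 x.2]
      simp only [h]
      exact sum_recover_fst hi b hτ y.1 y.2
    · rw [← sum_recover_snd hi b hτ x.1 x.2]
      simp only [h]
      exact sum_recover_snd hi b hτ y.1 y.2
  · intro y
    induction y with
    | zero => exact ⟨0, map_zero _⟩
    | add y z hy hz =>
      obtain ⟨u, rfl⟩ := hy
      obtain ⟨v, rfl⟩ := hz
      exact ⟨u + v, map_add _ _ _⟩
    | tmul a c =>
      obtain ⟨p, q, rfl⟩ := exists_eq_add_mul_gen hi c
      -- The preimage of `a ⊗ c` is `(a c, a τ(c))`.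
      refine ⟨(a * (algebraMap ℚ K p + algebraMap ℚ K q * i),
        a * (algebraMap ℚ K p - algebraMap ℚ K q * i)), ?_⟩
      have h1 : (a * (algebraMap ℚ K p + algebraMap ℚ K q * i) +
          a * (algebraMap ℚ K p - algebraMap ℚ K q * i)) / 2 = p • a := by
        rw [Algebra.smul_def]
        ring
      have h2 : i * (a * (algebraMap ℚ K p + algebraMap ℚ K q * i) -
          a * (algebraMap ℚ K p - algebraMap ℚ K q * i)) / 2 = -(q • a) := by
        rw [Algebra.smul_def]
        linear_combination (a * algebraMap ℚ K q) * hi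
      rw [splitHom_apply, h1, h2, TensorProduct.tmul_add, ← Algebra.smul_def (R := ℚ),
        TensorProduct.tmul_smul, Algebra.TensorProduct.algebraMap_apply,
        Algebra.TensorProduct.algebraMap_apply, Algebra.TensorProduct.tmul_mul_tmul, mul_one, one_mul,
        Algebra.algebraMap_self_apply, Algebra.algebraMap_self_apply, TensorProduct.neg_tmul,
        sub_neg_eq_add, TensorProduct.smul_tmul, TensorProduct.smul_tmul',
        Algebra.smul_def (A := adjoin ℚ {i}), mul_one]

/-- The isomorphism `K × K ≅ K ⊗ ℚ(i)`. -/
def splitEquiv : (K × K) ≃ₐ[K] K ⊗[ℚ] adjoin ℚ {i} :=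
  AlgEquiv.ofBijective _ (splitHom_bijective hi)

/-- `SL_n` of a product of two rings. -/
def specialLinearGroupProdEquiv (n : Type*) [Fintype n] [DecidableEq n] (R S : Type*) [CommRing R]
    [CommRing S] : Matrix.SpecialLinearGroup n R × Matrix.SpecialLinearGroup n S ≃*
      Matrix.SpecialLinearGroup n (R × S) :=
  MulEquiv.symm
  { toFun g := (Matrix.SpecialLinearGroup.map (RingHom.fst R S) g,
      Matrix.SpecialLinearGroup.map (RingHom.snd R S) g)
    invFun g := ⟨Matrix.of fun s t => (g.1 s t, g.2 s t), by
      refine Prod.ext ((RingHom.map_det (RingHom.fst R S) _).trans ?_)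
        ((RingHom.map_det (RingHom.snd R S) _).trans ?_)
      · exact g.1.det_coe
      · exact g.2.det_coe⟩
    left_inv g := rfl
    right_inv g := rfl
    map_mul' g h := by rw [map_mul, map_mul]; rfl }

/-- The map of `SL_n(K ⊗ k)` to the restriction of scalars of `SL_n`. -/
def expandHom (n : Type*) [Fintype n] [DecidableEq n] :
    Matrix.SpecialLinearGroup n (K ⊗[ℚ] adjoin ℚ {i}) →* restrictScalarsSL K n b where
  toFun Y := ⟨⟨expand K n b Y.1, det_of_mem K n b
      ((mem_restrictScalarsSet_slEquation K n b _).2 ⟨Y.1, Y.2, rfl⟩)⟩,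
    (mem_restrictScalarsSet_slEquation K n b _).2 ⟨Y.1, Y.2, rfl⟩⟩
  map_one' := Subtype.ext (Subtype.ext (expand_one K n b))
  map_mul' X Y := Subtype.ext (Subtype.ext (expand_mul K n b X.1 Y.1))

theorem expandHom_bijective (n : Type*) [Fintype n] [DecidableEq n] :
    Function.Bijective (expandHom b (K := K) n) := by
  constructor
  · intro X Y h
    have h' : expand K n b X.1 = expand K n b Y.1 := congrArg (fun z => z.1.1) h
    exact Subtype.ext (Matrix.map_injective (regularRep_injective b)
      ((Matrix.comp n n ι ι K).injective h'))
  · intro g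
    obtain ⟨Y, hY, hg⟩ := (mem_restrictScalarsSet_slEquation K n b _).1 g.2
    exact ⟨⟨Y, hY⟩, Subtype.ext (Subtype.ext hg.symm)⟩

/-- The isomorphism `SL_n(K × K) ≅ SL_n(K ⊗ ℚ(i))`. -/
def splitSpecialLinearGroupEquiv (n : Type*) [Fintype n] [DecidableEq n] :
    Matrix.SpecialLinearGroup n (K × K) ≃*
      Matrix.SpecialLinearGroup n (K ⊗[ℚ] adjoin ℚ {i}) where
  toFun := Matrix.SpecialLinearGroup.map (splitEquiv hi : K × K →+* K ⊗[ℚ] adjoin ℚ {i})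
  invFun := Matrix.SpecialLinearGroup.map
    ((splitEquiv hi).symm : K ⊗[ℚ] adjoin ℚ {i} →+* K × K)
  left_inv X := by
    refine Subtype.ext (Matrix.ext fun s t => ?_)
    exact (splitEquiv hi).symm_apply_apply _
  right_inv Y := by
    ext s t
    exact (splitEquiv hi).apply_symm_apply _
  map_mul' := map_mul _

/-- The isomorphism of `SL_n × SL_n` with the restriction of scalars of `SL_n`. -/
def pairEquiv (n : Type*) [Fintype n] [DecidableEq n] :
    Matrix.SpecialLinearGroup n K × Matrix.SpecialLinearGroup n K ≃* restrictScalarsSL K n b :=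
  ((specialLinearGroupProdEquiv n K K).trans (splitSpecialLinearGroupEquiv hi n)).trans
    (MulEquiv.ofBijective (expandHom b n) (expandHom_bijective b n))

include hτ in
-- Makes the abstract isomorphism explicit as `x e + y τ(e)`. The conjugation enters only this
-- description, not the map.
theorem coe_pairEquiv {n : Type*} [Fintype n] [DecidableEq n]
    (x y : Matrix.SpecialLinearGroup n K) :
    ((pairEquiv hi b n (x, y) : Matrix.SpecialLinearGroup (n × ι) K) :
      Matrix (n × ι) (n × ι) K) = pairMatrix b τ x y := by
  ext p q
  exact regularRep_splitHom hi b hτ (x p.1 q.1, y p.1 q.1) p.2 q.2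

end Splitting

/-! ### The isomorphism with `SL_n × SL_n` over `ℚ(i)` and its conjugate. -/

section Isomorphism

open IntermediateField AdjoinSimple

variable {K : Type*} [Field K] [CharZero K] {i : K} (hi : i ^ 2 = -1)
variable {ι : Type*} [Fintype ι] [DecidableEq ι] (b : Module.Basis ι ℚ (adjoin ℚ {i}))
variable {τ : adjoin ℚ {i} ≃ₐ[ℚ] adjoin ℚ {i}} (hτ : τ (gen ℚ i) = -gen ℚ i)

/-- The matrix whose `(s, t)` entry is the linear form with coefficients `W` in the entries of the
`(s, t)` block. -/
def blockForm (n : Type*) {A : Type*} [CommRing A] (W : Matrix ι ι A) :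
    Matrix n n (MvPolynomial ((n × ι) × (n × ι)) A) :=
  Matrix.of fun s t => ∑ l, ∑ m, MvPolynomial.C (W l m) * MvPolynomial.X ((s, l), (t, m))

omit [CharZero K] [DecidableEq ι] in
theorem aeval_blockForm {n A : Type*} [CommRing A] [Algebra A K] (W : Matrix ι ι A)
    (P : (n × ι) × (n × ι) → K) (s t : n) :
    MvPolynomial.aeval P (blockForm n W s t) =
      ∑ l, ∑ m, algebraMap A K (W l m) * P ((s, l), (t, m)) := by
  simp only [blockForm, Matrix.of_apply, map_sum, map_mul, MvPolynomial.aeval_C,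
    MvPolynomial.aeval_X]

omit [DecidableEq ι] in
theorem blockForm_map {n A B : Type*} [CommRing A] [CommRing B] (f : A →+* B)
    (W : Matrix ι ι A) :
    (blockForm n W).map (MvPolynomial.map f) = blockForm n (W.map f) := by
  ext1 s t
  simp only [blockForm, Matrix.map_apply, Matrix.of_apply, map_sum, map_mul, MvPolynomial.map_C,
    MvPolynomial.map_X]

include hi hτ in
theorem aeval_blockForm_recoverMatrix {n : Type*} (x y : Matrix n n K) (s t : n) :
    MvPolynomial.aeval (fun p => pairMatrix b τ x y p.1 p.2)
      (blockForm n (recoverMatrix b) s t) = x s t := by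
  rw [aeval_blockForm]
  exact sum_recover_fst hi b hτ (x s t) (y s t)

include hi hτ in
theorem aeval_blockForm_conj_recoverMatrix {n : Type*} (x y : Matrix n n K) (s t : n) :
    MvPolynomial.aeval (fun p => pairMatrix b τ x y p.1 p.2)
      (blockForm n ((recoverMatrix b).map τ) s t) = y s t := by
  rw [aeval_blockForm]
  exact sum_recover_snd hi b hτ (x s t) (y s t)

/-- The isomorphism `R_{ℚ(i)/ℚ} SL_n → SL_n × SL_n`. -/
def restrictScalarsEquivProd (n : Type*) [Fintype n] [DecidableEq n] :
    restrictScalarsSL K n b ≃* prod (⊤ : Subgroup (Matrix.SpecialLinearGroup n K))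
      (⊤ : Subgroup (Matrix.SpecialLinearGroup n K)) :=
  ((pairEquiv hi b n).symm.trans
    (MulEquiv.prodCongr Subgroup.topEquiv.symm Subgroup.topEquiv.symm)).trans (prodEquiv ⊤ ⊤)

variable {n : Type*} [Fintype n] [DecidableEq n]

theorem restrictScalarsEquivProd_pairEquiv (x y : Matrix.SpecialLinearGroup n K) :
    restrictScalarsEquivProd hi b n (pairEquiv hi b n (x, y)) =
      prodEquiv ⊤ ⊤ (⟨x, Subgroup.mem_top x⟩, ⟨y, Subgroup.mem_top y⟩) := by
  rw [restrictScalarsEquivProd, MulEquiv.trans_apply, MulEquiv.trans_apply,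
    MulEquiv.symm_apply_apply]
  rfl

theorem swapFactors_restrictScalarsEquivProd (x y : Matrix.SpecialLinearGroup n K) :
    swapFactors ⊤ (restrictScalarsEquivProd hi b n (pairEquiv hi b n (x, y))) =
      restrictScalarsEquivProd hi b n (pairEquiv hi b n (y, x)) := by
  rw [restrictScalarsEquivProd_pairEquiv, restrictScalarsEquivProd_pairEquiv, swapFactors,
    MulEquiv.trans_apply, MulEquiv.symm_apply_apply]
  rfl

theorem coe_restrictScalarsEquivProd (x y : Matrix.SpecialLinearGroup n K) :
    ((restrictScalarsEquivProd hi b n (pairEquiv hi b n (x, y)) :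
      Matrix.SpecialLinearGroup (n ⊕ n) K) : Matrix (n ⊕ n) (n ⊕ n) K) =
      Matrix.fromBlocks (x : Matrix n n K) 0 0 (y : Matrix n n K) := by
  rw [restrictScalarsEquivProd_pairEquiv]
  rfl

/-- The map and the coefficient matrices are left arbitrary so that the same criterion serves the
isomorphism and its composite with the swap. -/
theorem representedBy_restrictScalarsEquivProd {W W' : Matrix ι ι (adjoin ℚ {i})}
    {f : restrictScalarsSL K n b → prod (⊤ : Subgroup (Matrix.SpecialLinearGroup n K))
      (⊤ : Subgroup (Matrix.SpecialLinearGroup n K))}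
    (hf : ∀ x y, ∃ x' y', f (pairEquiv hi b n (x, y)) =
        restrictScalarsEquivProd hi b n (pairEquiv hi b n (x', y')) ∧
      (∀ s t, MvPolynomial.aeval (entries ((pairEquiv hi b n (x, y) :
        Matrix.SpecialLinearGroup (n × ι) K) : Matrix (n × ι) (n × ι) K)) (blockForm n W s t) =
          x' s t) ∧
      (∀ s t, MvPolynomial.aeval (entries ((pairEquiv hi b n (x, y) :
        Matrix.SpecialLinearGroup (n × ι) K) : Matrix (n × ι) (n × ι) K)) (blockForm n W' s t) =
          y' s t)) :
    RepresentedBy f (Matrix.fromBlocks (blockForm n W) 0 0 (blockForm n W')) := by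
  intro g
  obtain ⟨⟨x, y⟩, rfl⟩ := (pairEquiv hi b n).surjective g
  obtain ⟨x', y', hxy, hx, hy⟩ := hf x y
  rw [hxy, coe_restrictScalarsEquivProd, Matrix.fromBlocks_map]
  congr 1
  · ext s t
    exact (hx s t).symm
  · ext s t
    exact (hy s t).symm

include hτ in
theorem isIsomorphismOver_restrictScalarsEquivProd :
    IsIsomorphismOver (adjoin ℚ {i}) (restrictScalarsEquivProd hi b n) := by
  refine ⟨⟨_, representedBy_restrictScalarsEquivProd hi b (W := recoverMatrix b)
    (W' := (recoverMatrix b).map τ) fun x y => ⟨x, y, rfl, ?_, ?_⟩⟩,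
    Matrix.of fun p q =>
      MvPolynomial.X (Sum.inl p.1, Sum.inl q.1) * MvPolynomial.C (idemMatrix b p.2 q.2) +
      MvPolynomial.X (Sum.inr p.1, Sum.inr q.1) * MvPolynomial.C (τ (idemMatrix b p.2 q.2)), ?_⟩
  · rw [coe_pairEquiv hi b hτ]
    exact aeval_blockForm_recoverMatrix hi b hτ _ _
  · rw [coe_pairEquiv hi b hτ]
    exact aeval_blockForm_conj_recoverMatrix hi b hτ _ _
  · intro g
    obtain ⟨g, rfl⟩ := (restrictScalarsEquivProd hi b n).surjective g
    obtain ⟨⟨x, y⟩, rfl⟩ := (pairEquiv hi b n).surjective g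
    rw [MulEquiv.symm_apply_apply, coe_pairEquiv hi b hτ, coe_restrictScalarsEquivProd]
    ext p q
    simp [pairMatrix, entries]

include hτ in
-- The two diagonal blocks are given by linear forms conjugate to each other, and `τ` is an
-- involution; conjugating the coefficients therefore exchanges the blocks.
theorem isConjugateBy_restrictScalarsEquivProd :
    IsConjugateBy (K := K) τ.toAlgHom.toRingHom (restrictScalarsEquivProd hi b n)
      (fun g => swapFactors ⊤ (restrictScalarsEquivProd hi b n g)) := by
  refine ⟨_, representedBy_restrictScalarsEquivProd hi b (W := recoverMatrix b)
    (W' := (recoverMatrix b).map τ) fun x y => ⟨x, y, rfl, ?_, ?_⟩, ?_⟩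
  · rw [coe_pairEquiv hi b hτ]
    exact aeval_blockForm_recoverMatrix hi b hτ _ _
  · rw [coe_pairEquiv hi b hτ]
    exact aeval_blockForm_conj_recoverMatrix hi b hτ _ _
  · have hW : ((recoverMatrix b).map τ).map τ.toAlgHom.toRingHom = recoverMatrix b := by
      ext1 l m
      exact conj_conj hi hτ _
    rw [Matrix.fromBlocks_map, blockForm_map, blockForm_map, hW,
      Matrix.map_zero _ (map_zero _)]
    refine representedBy_restrictScalarsEquivProd hi b fun x y =>
      ⟨y, x, swapFactors_restrictScalarsEquivProd hi b x y, ?_, ?_⟩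
    · rw [coe_pairEquiv hi b hτ]
      exact aeval_blockForm_conj_recoverMatrix hi b hτ _ _
    · rw [coe_pairEquiv hi b hτ]
      exact aeval_blockForm_recoverMatrix hi b hτ _ _

include hi hτ in
theorem map_algebraMap_eq_conj {σ : K ≃+* K} (hσ : σ i = -i) (c : adjoin ℚ {i}) :
    σ (algebraMap _ K c) = algebraMap _ K (τ c) := by
  obtain ⟨p, q, rfl⟩ := exists_eq_add_mul_gen hi c
  simp only [map_add, map_mul, AlgEquiv.commutes, hτ, map_neg, AdjoinSimple.algebraMap_gen, hσ,
    ← IsScalarTower.algebraMap_apply]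
  simp

include hτ in
-- On `ℚ(i)` the automorphism `σ` agrees with `τ`, so it sends `x e + y τ(e)` to `σ(y) e + σ(x)
-- τ(e)`.
theorem map_coe_pairEquiv {σ : K ≃+* K} (hσ : σ i = -i) (x y : Matrix.SpecialLinearGroup n K) :
    (pairEquiv hi b n (Matrix.SpecialLinearGroup.map (σ : K →+* K) y,
        Matrix.SpecialLinearGroup.map (σ : K →+* K) x) : Matrix.SpecialLinearGroup (n × ι) K) =
      Matrix.SpecialLinearGroup.map (σ : K →+* K)
        (pairEquiv hi b n (x, y) : Matrix.SpecialLinearGroup (n × ι) K) := by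
  apply Subtype.ext
  rw [coe_pairEquiv hi b hτ]
  ext p q
  change _ = σ ((pairEquiv hi b n (x, y) : Matrix.SpecialLinearGroup (n × ι) K).1 p q)
  rw [coe_pairEquiv hi b hτ]
  simp only [pairMatrix, Matrix.of_apply, map_add, map_mul, map_algebraMap_eq_conj hi hτ hσ,
    conj_conj hi hτ]
  exact add_comm _ _

theorem exists_map_eq {σ : K ≃+* K} (hσ : σ i = -i) (g : restrictScalarsSL K n b) :
    ∃ g' : restrictScalarsSL K n b,
      (g' : Matrix.SpecialLinearGroup (n × ι) K) =
        Matrix.SpecialLinearGroup.map (σ : K →+* K) (g : Matrix.SpecialLinearGroup (n × ι) K) ∧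
      (restrictScalarsEquivProd hi b n g' : Matrix.SpecialLinearGroup (n ⊕ n) K) =
        Matrix.SpecialLinearGroup.map (σ : K →+* K)
          (swapFactors ⊤ (restrictScalarsEquivProd hi b n g) :
            Matrix.SpecialLinearGroup (n ⊕ n) K) := by
  obtain ⟨τ, hτ⟩ := exists_conj hi
  obtain ⟨⟨x, y⟩, rfl⟩ := (pairEquiv hi b n).surjective g
  refine ⟨_, map_coe_pairEquiv hi b hτ hσ x y, ?_⟩
  rw [swapFactors_restrictScalarsEquivProd]
  apply Subtype.ext
  rw [coe_restrictScalarsEquivProd]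
  have h := coe_restrictScalarsEquivProd hi b y x
  ext p q
  change _ = σ ((restrictScalarsEquivProd hi b n (pairEquiv hi b n (y, x)) :
    Matrix.SpecialLinearGroup (n ⊕ n) K).1 p q)
  rw [h]
  rcases p with p | p <;> rcases q with q | q <;> simp

end Isomorphism

/-! ### Field of definition, connectedness and normal subgroups of the restriction of scalars. -/

section Simplicity

open IntermediateField AdjoinSimple

theorem entries_mem_points {K : Type*} [Field K] {n : Type*} [Fintype n] [DecidableEq n]
    {L : Subgroup (Matrix.SpecialLinearGroup n K)} {g : Matrix.SpecialLinearGroup n K} :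
    entries (g : Matrix n n K) ∈ points L ↔ g ∈ L := by
  constructor
  · rintro ⟨h, hh, hhg⟩
    have : h = g := by
      ext s t
      exact congrFun hhg (s, t)
    exact this ▸ hh
  · exact fun h => ⟨g, h, rfl⟩

/-- Every closed subgroup is defined over the ground field itself. -/
theorem definedOver_self {K : Type*} [Field K] {n : Type*} [Fintype n] [DecidableEq n]
    {L : Subgroup (Matrix.SpecialLinearGroup n K)}
    (hL : @IsClosed (n × n → K) (zariskiTopology K (n × n)) (points L)) : DefinedOver K L := by
  refine ⟨hL, (MvPolynomial.vanishingIdeal K (points L) : Set _), ?_⟩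
  have hid : ⇑(MvPolynomial.map (σ := n × n) (algebraMap K K)) = id :=
    funext fun p => MvPolynomial.map_id p
  rw [hid, Set.image_id, Ideal.span_eq]

variable {K : Type*} [Field K] [CharZero K] {i : K} (hi : i ^ 2 = -1)
variable {ι : Type*} [Fintype ι] [DecidableEq ι] (b : Module.Basis ι ℚ (adjoin ℚ {i}))
variable {τ : adjoin ℚ {i} ≃ₐ[ℚ] adjoin ℚ {i}} (hτ : τ (gen ℚ i) = -gen ℚ i)

include hi hτ in
theorem points_restrictScalarsSL_eq_range_pairMatrix (n : Type*) [Fintype n] [DecidableEq n] :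
    points (restrictScalarsSL K n b) =
      Set.range fun g : Matrix.SpecialLinearGroup n K × Matrix.SpecialLinearGroup n K =>
        entries (pairMatrix b τ (g.1 : Matrix n n K) (g.2 : Matrix n n K)) := by
  ext P
  constructor
  · rintro ⟨g, hg, rfl⟩
    obtain ⟨⟨x, y⟩, hxy⟩ := (pairEquiv hi b n).surjective ⟨g, hg⟩
    refine ⟨(x, y), ?_⟩
    dsimp only
    rw [← coe_pairEquiv hi b hτ, hxy]
  · rintro ⟨⟨x, y⟩, rfl⟩
    exact ⟨_, (pairEquiv hi b n (x, y)).2, congrArg entries (coe_pairEquiv hi b hτ x y)⟩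

include hi hτ in
-- Gives explicit polynomial equations: a point must be rebuilt from the two matrices recovered from
-- it, and both must have determinant `1`.
theorem mem_points_restrictScalarsSL_iff (n : Type*) [Fintype n] [DecidableEq n]
    (P : (n × ι) × (n × ι) → K) : P ∈ points (restrictScalarsSL K n b) ↔
      (∀ p, P p = pairMatrix b τ ((blockForm n (recoverMatrix b)).map (MvPolynomial.aeval P))
        ((blockForm n ((recoverMatrix b).map τ)).map (MvPolynomial.aeval P)) p.1 p.2) ∧
      ((blockForm n (recoverMatrix b)).map (MvPolynomial.aeval P)).det = 1 ∧
      ((blockForm n ((recoverMatrix b).map τ)).map (MvPolynomial.aeval P)).det = 1 := by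
  rw [points_restrictScalarsSL_eq_range_pairMatrix hi b hτ]
  constructor
  · rintro ⟨⟨x, y⟩, rfl⟩
    have h1 : (blockForm n (recoverMatrix b)).map (MvPolynomial.aeval
        (entries (pairMatrix b τ (x : Matrix n n K) (y : Matrix n n K)))) = x := by
      ext1 s t
      exact aeval_blockForm_recoverMatrix hi b hτ _ _ s t
    have h2 : (blockForm n ((recoverMatrix b).map τ)).map (MvPolynomial.aeval
        (entries (pairMatrix b τ (x : Matrix n n K) (y : Matrix n n K)))) = y := by
      ext1 s t
      exact aeval_blockForm_conj_recoverMatrix hi b hτ _ _ s t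
    dsimp only
    rw [h1, h2]
    exact ⟨fun p => rfl, x.det_coe, y.det_coe⟩
  · rintro ⟨h, hx, hy⟩
    exact ⟨(⟨_, hx⟩, ⟨_, hy⟩), funext fun p => (h p).symm⟩

omit [CharZero K] [DecidableEq ι] in
theorem aeval_blockForm_map {n A : Type*} [CommRing A] [Algebra A K] (W : Matrix ι ι A)
    (P : (n × ι) × (n × ι) → K) (s t : n) :
    MvPolynomial.aeval P (blockForm n (W.map (algebraMap A K)) s t) =
      MvPolynomial.aeval P (blockForm n W s t) := by
  rw [aeval_blockForm, aeval_blockForm]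
  rfl

include hi in
theorem isClosed_points_restrictScalarsSL (n : Type*) [Fintype n] [DecidableEq n] :
    @IsClosed ((n × ι) × (n × ι) → K) (zariskiTopology K ((n × ι) × (n × ι)))
      (points (restrictScalarsSL K n b)) := by
  obtain ⟨τ, hτ⟩ := exists_conj hi
  let := zariskiTopology K ((n × ι) × (n × ι))
  let A := blockForm n ((recoverMatrix b).map (algebraMap _ K))
  let B := blockForm n (((recoverMatrix b).map τ).map (algebraMap _ K))
  have hA : ∀ P, A.map (MvPolynomial.aeval P) =
      (blockForm n (recoverMatrix b)).map (MvPolynomial.aeval P) := fun P => by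
    ext1 s t
    exact aeval_blockForm_map _ P s t
  have hB : ∀ P, B.map (MvPolynomial.aeval P) =
      (blockForm n ((recoverMatrix b).map τ)).map (MvPolynomial.aeval P) := fun P => by
    ext1 s t
    exact aeval_blockForm_map _ P s t
  have hdet : ∀ (M : Matrix n n (MvPolynomial ((n × ι) × (n × ι)) K))
      (P : (n × ι) × (n × ι) → K),
      MvPolynomial.aeval P M.det = (M.map (MvPolynomial.aeval P)).det := fun M P =>
    AlgHom.map_det (MvPolynomial.aeval (R := K) P) M
  convert ((isClosed_zariski_setOf_aeval_eq (K := K) MvPolynomial.X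
    fun p : (n × ι) × (n × ι) =>
      A p.1.1 p.2.1 * MvPolynomial.C (algebraMap _ K (idemMatrix b p.1.2 p.2.2)) +
      B p.1.1 p.2.1 * MvPolynomial.C (algebraMap _ K (τ (idemMatrix b p.1.2 p.2.2)))).inter
    ((isClosed_zariski_setOf_aeval_eq (K := K) (fun _ : Unit => A.det) fun _ => 1).inter
      (isClosed_zariski_setOf_aeval_eq (K := K) (fun _ : Unit => B.det) fun _ => 1))) using 1
  ext P
  rw [mem_points_restrictScalarsSL_iff hi b hτ]
  simp only [Set.mem_inter_iff, Set.mem_ofPred_eq, hdet, hA, hB, map_one, forall_const]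
  refine and_congr_left' (forall_congr' fun p => ?_)
  rw [MvPolynomial.aeval_X, map_add, map_mul, map_mul, MvPolynomial.aeval_C, MvPolynomial.aeval_C,
    ← hA, ← hB]
  rfl

/-- The polynomials parametrizing the restriction of scalars of `SL₂`. -/
def paramMatrix : Matrix (Fin 2 × ι) (Fin 2 × ι) (MvPolynomial (Fin 4 × Fin 2) ℚ) :=
  -- Each of the four parameters in `K ⊗ ℚ(i)` is `u + vJ` with two free coordinates, so the
  -- coefficients stay rational.
  Matrix.comp _ _ _ _ _ (fourElementary fun j =>
    (MvPolynomial.X (j, 0) : MvPolynomial (Fin 4 × Fin 2) ℚ) • (1 : Matrix ι ι _) +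
      (MvPolynomial.X (j, 1) : MvPolynomial (Fin 4 × Fin 2) ℚ) •
        (genMatrix b).map MvPolynomial.C)

theorem regularRep_splitHom_add_sub (u v : K) :
    regularRep K b (splitHom hi (1 ⊗ₜ gen ℚ i) (one_tmul_gen_mul_self hi)
      (u + v * i, u - v * i)) = u • 1 + v • (genMatrix b).map (algebraMap ℚ K) := by
  have h1 : (u + v * i + (u - v * i)) / 2 = u := by ring
  have h2 : i * (u + v * i - (u - v * i)) / 2 = -v := by linear_combination v * hi
  rw [splitHom_apply, h1, h2, map_sub, map_mul, AlgHom.commutes, AlgHom.commutes,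
    regularRep_one_tmul, ← Algebra.smul_def, Algebra.algebraMap_eq_smul_one, neg_smul,
    sub_neg_eq_add]
  rfl

include hi hτ in
-- `fourElementary` commutes with ring homomorphisms, so the product can be formed among polynomial
-- matrices, in `M_ι(K)`, or in `K × K`, where `u + vJ` corresponds to `(u + vi, u - vi)`.
theorem aeval_paramMatrix (u : Fin 4 × Fin 2 → K) (p q : Fin 2 × ι) :
    MvPolynomial.aeval u (paramMatrix b p q) =
      pairMatrix b τ (fourElementary fun j => u (j, 0) + u (j, 1) * i)
        (fourElementary fun j => u (j, 0) - u (j, 1) * i) p q := by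
  let z : Fin 4 → K × K := fun j => (u (j, 0) + u (j, 1) * i, u (j, 0) - u (j, 1) * i)
  have h1 := fourElementary_map (RingHom.fst K K) z
  have h2 := fourElementary_map (RingHom.snd K K) z
  have h3 := fourElementary_map (((regularRep K b).comp
    (splitHom hi (1 ⊗ₜ gen ℚ i) (one_tmul_gen_mul_self hi))).toRingHom) z
  let w : Fin 4 → Matrix ι ι (MvPolynomial (Fin 4 × Fin 2) ℚ) := fun j =>
    (MvPolynomial.X (j, 0) : MvPolynomial (Fin 4 × Fin 2) ℚ) • (1 : Matrix ι ι _) +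
      (MvPolynomial.X (j, 1) : MvPolynomial (Fin 4 × Fin 2) ℚ) •
        (genMatrix b).map MvPolynomial.C
  have h4 := fourElementary_map ((MvPolynomial.aeval u).toRingHom.mapMatrix :
    Matrix ι ι (MvPolynomial (Fin 4 × Fin 2) ℚ) →+* Matrix ι ι K) w
  have h5 : ∀ j, ((regularRep K b).comp
      (splitHom hi (1 ⊗ₜ gen ℚ i) (one_tmul_gen_mul_self hi))).toRingHom (z j) =
      ((MvPolynomial.aeval u).toRingHom.mapMatrix :
        Matrix ι ι (MvPolynomial (Fin 4 × Fin 2) ℚ) →+* Matrix ι ι K) (w j) := by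
    intro j
    refine (regularRep_splitHom_add_sub hi b _ _).trans ?_
    ext l m
    simp [w, Matrix.one_apply]
    split_ifs <;> simp
  simp only [h5] at h3
  have h6 := h4.trans h3.symm
  calc MvPolynomial.aeval u (paramMatrix b p q) = _ := congrFun₂ (congrFun₂ h6 p.1 q.1) p.2 q.2
    _ = _ := regularRep_splitHom hi b hτ _ p.2 q.2
    _ = _ := by
      rw [pairMatrix, Matrix.of_apply]
      congr 2
      · exact congrFun₂ h1 p.1 q.1
      · exact congrFun₂ h2 p.1 q.1

include hi in
theorem points_restrictScalarsSL_eq_range_aeval :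
    points (restrictScalarsSL K (Fin 2) b) = Set.range fun (u : Fin 4 × Fin 2 → K) p =>
      MvPolynomial.aeval u (paramMatrix b p.1 p.2) := by
  obtain ⟨τ, hτ⟩ := exists_conj hi
  rw [points_restrictScalarsSL_eq_range_pairMatrix hi b hτ]
  ext P
  constructor
  · rintro ⟨⟨x, y⟩, rfl⟩
    obtain ⟨v, hv⟩ := exists_eq_fourElementary x
    obtain ⟨w, hw⟩ := exists_eq_fourElementary y
    -- The solution of `α + βi = v j`, `α - βi = w j` has `β = (v j - w j)/(2i) = i(w j - v j)/2`.
    refine ⟨fun j => ![(v j.1 + w j.1) / 2, i * (w j.1 - v j.1) / 2] j.2, ?_⟩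
    ext p
    dsimp only
    rw [aeval_paramMatrix hi b hτ, hv, hw]
    have h1 : ∀ j, (v j + w j) / 2 + i * (w j - v j) / 2 * i = v j := fun j => by
      linear_combination ((w j - v j) / 2) * hi
    have h2 : ∀ j, (v j + w j) / 2 - i * (w j - v j) / 2 * i = w j := fun j => by
      linear_combination (-(w j - v j) / 2) * hi
    simp [h1, h2, entries]
  · rintro ⟨u, rfl⟩
    refine ⟨(⟨_, det_fourElementary fun j => u (j, 0) + u (j, 1) * i⟩,
      ⟨_, det_fourElementary fun j => u (j, 0) - u (j, 1) * i⟩), ?_⟩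
    ext p
    exact (aeval_paramMatrix hi b hτ u p.1 p.2).symm

include hi in
theorem definedOver_restrictScalarsSL : DefinedOver ℚ (restrictScalarsSL K (Fin 2) b) := by
  rw [DefinedOver, points_restrictScalarsSL_eq_range_aeval hi]
  apply varietyDefinedOver_range_aeval
  rw [← points_restrictScalarsSL_eq_range_aeval hi]
  exact isClosed_points_restrictScalarsSL hi b (Fin 2)

include hi in
theorem zariskiConnected_restrictScalarsSL :
    ZariskiConnected (restrictScalarsSL K (Fin 2) b) := by
  rw [ZariskiConnected, points_restrictScalarsSL_eq_range_aeval hi]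
  exact isConnected_range_aeval _

/-- The preimage of the first factor under the isomorphism `R_{ℚ(i)/ℚ} SL_n ≅ SL_n × SL_n`. -/
def firstFactor (n : Type*) [Fintype n] [DecidableEq n] :
    Subgroup (Matrix.SpecialLinearGroup (n × ι) K) :=
  ((((⊤ : Subgroup (Matrix.SpecialLinearGroup n K)).prod ⊥).map
    (pairEquiv hi b n).toMonoidHom)).map (restrictScalarsSL K n b).subtype

theorem mem_firstFactor_iff {n : Type*} [Fintype n] [DecidableEq n]
    {g : Matrix.SpecialLinearGroup (n × ι) K} :
    g ∈ firstFactor hi b n ↔ ∃ x, (pairEquiv hi b n (x, 1) : Matrix.SpecialLinearGroup _ K) = g := by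
  constructor
  · rintro ⟨_, ⟨⟨x, y⟩, ⟨-, hy⟩, rfl⟩, rfl⟩
    obtain rfl : y = 1 := hy
    exact ⟨x, rfl⟩
  · rintro ⟨x, rfl⟩
    exact ⟨_, ⟨(x, 1), ⟨trivial, rfl⟩, rfl⟩, rfl⟩

theorem firstFactor_le (n : Type*) [Fintype n] [DecidableEq n] :
    firstFactor hi b n ≤ restrictScalarsSL K n b :=
  Subgroup.map_subtype_le _

theorem firstFactor_normal (n : Type*) [Fintype n] [DecidableEq n] :
    ((firstFactor hi b n).subgroupOf (restrictScalarsSL K n b)).Normal := by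
  rw [firstFactor, Subgroup.subgroupOf, Subgroup.comap_map_eq_self_of_injective
    (Subgroup.subtype_injective _)]
  exact Subgroup.Normal.map inferInstance _ (pairEquiv hi b n).surjective

include hτ in
theorem points_firstFactor (n : Type*) [Fintype n] [DecidableEq n] :
    points (firstFactor hi b n) = Set.range fun x : Matrix.SpecialLinearGroup n K =>
      entries (pairMatrix b τ (x : Matrix n n K) 1) := by
  ext P
  constructor
  · rintro ⟨g, hg, rfl⟩
    obtain ⟨x, rfl⟩ := (mem_firstFactor_iff hi b).1 hg
    refine ⟨x, ?_⟩
    dsimp only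
    rw [coe_pairEquiv hi b hτ, Matrix.SpecialLinearGroup.coe_one]
  · rintro ⟨x, rfl⟩
    refine ⟨_, (mem_firstFactor_iff hi b).2 ⟨x, rfl⟩, ?_⟩
    dsimp only
    rw [coe_pairEquiv hi b hτ, Matrix.SpecialLinearGroup.coe_one]

theorem isClosed_points_firstFactor (n : Type*) [Fintype n] [DecidableEq n] :
    @IsClosed ((n × ι) × (n × ι) → K) (zariskiTopology K ((n × ι) × (n × ι)))
      (points (firstFactor hi b n)) := by
  obtain ⟨τ, hτ⟩ := exists_conj hi
  let := zariskiTopology K ((n × ι) × (n × ι))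
  convert (isClosed_points_restrictScalarsSL hi b n).inter
    (isClosed_zariski_setOf_aeval_eq (K := K)
      (fun p : n × n => blockForm n (((recoverMatrix b).map τ).map (algebraMap _ K)) p.1 p.2)
      (fun p => MvPolynomial.C ((1 : Matrix n n K) p.1 p.2))) using 1
  rw [points_firstFactor hi b hτ, points_restrictScalarsSL_eq_range_pairMatrix hi b hτ]
  ext P
  constructor
  · rintro ⟨x, rfl⟩
    refine ⟨⟨(x, 1), by dsimp only; rw [Matrix.SpecialLinearGroup.coe_one]⟩, fun p => ?_⟩
    rw [aeval_blockForm_map, MvPolynomial.aeval_C]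
    exact aeval_blockForm_conj_recoverMatrix hi b hτ _ _ p.1 p.2
  · rintro ⟨⟨⟨x, y⟩, rfl⟩, h⟩
    have hy : (y : Matrix n n K) = 1 := by
      ext1 s t
      have hst := h (s, t)
      rw [aeval_blockForm_map, MvPolynomial.aeval_C] at hst
      exact (aeval_blockForm_conj_recoverMatrix hi b hτ _ _ s t).symm.trans hst
    exact ⟨x, by dsimp only; rw [hy]⟩

theorem zariskiConnected_firstFactor : ZariskiConnected (firstFactor hi b (Fin 2)) := by
  obtain ⟨τ, hτ⟩ := exists_conj hi
  rw [ZariskiConnected]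
  -- The second component is frozen at `1`, leaving four parameters. The parametrization has
  -- coefficients in `K`, which is enough for connectedness.
  convert isConnected_range_aeval (K := K) (k := K) (υ := Fin 4)
    (σ := (Fin 2 × ι) × (Fin 2 × ι)) (fun p =>
      fourElementary (MvPolynomial.X : Fin 4 → MvPolynomial (Fin 4) K) p.1.1 p.2.1 *
        MvPolynomial.C (algebraMap _ K (idemMatrix b p.1.2 p.2.2)) +
      MvPolynomial.C ((1 : Matrix (Fin 2) (Fin 2) K) p.1.1 p.2.1 *
        algebraMap _ K (τ (idemMatrix b p.1.2 p.2.2)))) using 1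
  have key : ∀ u : Fin 4 → K, ∀ s t, MvPolynomial.aeval u
      (fourElementary (MvPolynomial.X : Fin 4 → MvPolynomial (Fin 4) K) s t) =
        fourElementary u s t := by
    intro u s t
    have h := congrFun₂ (fourElementary_map (MvPolynomial.aeval (R := K) u).toRingHom
      (MvPolynomial.X : Fin 4 → MvPolynomial (Fin 4) K)) s t
    refine h.trans ?_
    congr 1
    ext j
    simp
  rw [points_firstFactor hi b hτ]
  ext P
  simp only [map_add, map_mul, key, MvPolynomial.aeval_C, Algebra.algebraMap_self_apply]
  constructor
  · rintro ⟨x, rfl⟩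
    obtain ⟨u, hu⟩ := exists_eq_fourElementary x
    exact ⟨u, by dsimp only; rw [hu]; rfl⟩
  · rintro ⟨u, rfl⟩
    exact ⟨⟨_, det_fourElementary u⟩, rfl⟩

/-- The elementary matrix with entry `1` in the upper right corner. -/
def upperOne (R : Type*) [CommRing R] : SL(2, R) :=
  Matrix.SpecialLinearGroup.transvection (zero_ne_one (α := Fin 2)) 1

theorem upperOne_notMem_center (F : Type*) [Field F] :
    upperOne F ∉ Subgroup.center SL(2, F) := by
  rw [upperOne, Matrix.SpecialLinearGroup.transvection_mem_center_iff]
  exact one_ne_zero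

theorem upperOne_ne_one (F : Type*) [Field F] : upperOne F ≠ 1 := fun h =>
  upperOne_notMem_center F (h ▸ Subgroup.one_mem _)

include hi in
theorem not_isSimpleOver_restrictScalarsSL :
    ¬ IsSimpleOver K (restrictScalarsSL K (Fin 2) b) := by
  rintro ⟨-, -, -, h⟩
  rcases h (firstFactor hi b (Fin 2)) (firstFactor_le hi b _) (firstFactor_normal hi b _)
    (definedOver_self (isClosed_points_firstFactor hi b _)) (zariskiConnected_firstFactor hi b)
    with h | h
  · have h1 := (mem_firstFactor_iff hi b).2 ⟨upperOne K, rfl⟩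
    rw [h, Subgroup.mem_bot, OneMemClass.coe_eq_one, map_eq_one_iff _ (pairEquiv hi b _).injective,
      Prod.mk_eq_one] at h1
    exact upperOne_ne_one K h1.1
  · have h1 := h.ge (pairEquiv hi b (Fin 2) (1, upperOne K)).2
    obtain ⟨x, hx⟩ := (mem_firstFactor_iff hi b).1 h1
    have h2 := (pairEquiv hi b (Fin 2)).injective (Subtype.ext hx)
    exact upperOne_ne_one K (congrArg Prod.snd h2).symm

/-- For rational `x, y` the point `x e + y τ(e)` has coordinates in `ℚ(i)`, and `τ` carries it to `y
e + x τ(e)`. Rationality of the entries is what lets `τ` act without being extended to `K`. -/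
theorem VarietyDefinedOver.pairMatrix_swap_mem {n : Type*} {V : Set ((n × ι) × (n × ι) → K)}
    (hV : VarietyDefinedOver ℚ V) (hi : i ^ 2 = -1) (hτ : τ (gen ℚ i) = -gen ℚ i)
    {x y : Matrix n n ℚ}
    (h : entries (pairMatrix b τ (x.map (algebraMap ℚ K)) (y.map (algebraMap ℚ K))) ∈ V) :
    entries (pairMatrix b τ (y.map (algebraMap ℚ K)) (x.map (algebraMap ℚ K))) ∈ V := by
  have h' := hV.comp_mem (k := adjoin ℚ {i}) τ.toAlgHom (q := fun p =>
    algebraMap ℚ _ (x p.1.1 p.2.1) * idemMatrix b p.1.2 p.2.2 +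
      algebraMap ℚ _ (y p.1.1 p.2.1) * τ (idemMatrix b p.1.2 p.2.2)) (by
      convert h using 1
      ext p
      rw [map_add, map_mul, map_mul, ← IsScalarTower.algebraMap_apply,
        ← IsScalarTower.algebraMap_apply]
      rfl)
  convert h' using 1
  ext p
  change _ = algebraMap _ K (τ _)
  rw [map_add, map_mul, map_mul, AlgEquiv.commutes, AlgEquiv.commutes, conj_conj hi hτ, map_add,
    map_mul, map_mul, ← IsScalarTower.algebraMap_apply, ← IsScalarTower.algebraMap_apply, add_comm]
  rfl

theorem coe_upperOne_eq_map (R S : Type*) [CommRing R] [CommRing S] (f : R →+* S) :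
    ((upperOne S : SL(2, S)) : Matrix (Fin 2) (Fin 2) S) =
      ((upperOne R : SL(2, R)) : Matrix (Fin 2) (Fin 2) R).map f := by
  ext s t
  fin_cases s <;> fin_cases t <;>
    simp [upperOne, Matrix.SpecialLinearGroup.transvection_coe, Matrix.single]

theorem finite_center_specialLinearGroup (n : Type*) [Fintype n] [DecidableEq n] [Nonempty n]
    (F : Type*) [Field F] :
    (Subgroup.center (Matrix.SpecialLinearGroup n F) : Set (Matrix.SpecialLinearGroup n F)).Finite := by
  have : Finite (Subgroup.center (Matrix.SpecialLinearGroup n F)) :=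
    Finite.of_equiv _ (Matrix.SpecialLinearGroup.center_equiv_rootsOfUnity'
      (R := F) (Classical.arbitrary n)).symm.toEquiv
  exact Set.toFinite _

include hi in
theorem isSimpleOver_restrictScalarsSL : IsSimpleOver ℚ (restrictScalarsSL K (Fin 2) b) := by
  obtain ⟨τ, hτ⟩ := exists_conj hi
  have hF : ∃ a : K, a ≠ 0 ∧ a ^ 2 ≠ 1 := ⟨2, two_ne_zero, by norm_num⟩
  refine ⟨definedOver_restrictScalarsSL hi b, zariskiConnected_restrictScalarsSL hi b, ?_, ?_⟩
  · by_contra! h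
    refine upperOne_notMem_center K (Subgroup.mem_center_iff.2 fun g => ?_)
    have h1 := h _ (pairEquiv hi b (Fin 2) (g, 1)).2 _ (pairEquiv hi b (Fin 2) (upperOne K, 1)).2
    rw [← Subgroup.coe_mul, ← Subgroup.coe_mul, ← map_mul, ← map_mul] at h1
    exact congrArg Prod.fst ((pairEquiv hi b (Fin 2)).injective (Subtype.ext h1))
  intro L hLH hLn hLQ hLc
  let L' := (L.subgroupOf (restrictScalarsSL K (Fin 2) b)).comap (pairEquiv hi b (Fin 2)).toMonoidHom
  have hL' : ∀ x y, (x, y) ∈ L' ↔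
      entries (pairMatrix b τ (x : Matrix (Fin 2) (Fin 2) K) (y : Matrix (Fin 2) (Fin 2) K)) ∈
        points L := by
    intro x y
    rw [← coe_pairEquiv hi b hτ, entries_mem_points]
    rfl
  have : L'.Normal := hLn.comap _
  have hone : (1 : Matrix (Fin 2) (Fin 2) K) =
      (1 : Matrix (Fin 2) (Fin 2) ℚ).map (algebraMap ℚ K) := by
    rw [Matrix.map_one _ (map_zero _) (map_one _)]
  -- One noncentral element in each factor suffices: normality then gives both factors in full,
  -- hence all products.
  have htop : (upperOne K, 1) ∈ L' → (1, upperOne K) ∈ L' → L = restrictScalarsSL K (Fin 2) b := by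
    intro h1 h2
    refine le_antisymm hLH fun g hg => ?_
    obtain ⟨⟨x, y⟩, hxy⟩ := (pairEquiv hi b (Fin 2)).surjective ⟨g, hg⟩
    have hmem : (x, y) ∈ L' := by
      have := L'.mul_mem (mk_one_mem_of_normal hF L' h1 (upperOne_notMem_center K) x)
        (one_mk_mem_of_normal hF L' h2 (upperOne_notMem_center K) y)
      rwa [Prod.mk_mul_mk, mul_one, one_mul] at this
    have h3 : (pairEquiv hi b (Fin 2) (x, y) : Matrix.SpecialLinearGroup _ K) ∈ L := hmem
    rwa [hxy] at h3
  by_cases hcen : ∃ x y, (x, y) ∈ L' ∧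
      (x ∉ Subgroup.center SL(2, K) ∨ y ∉ Subgroup.center SL(2, K))
  · right
    obtain ⟨x, y, hxy, hx | hy⟩ := hcen
    -- The given `x` need not be rational, but `L'` now contains the whole first factor, so it can
    -- be replaced by a rational unipotent that conjugation moves to the other factor.
    · have h1 := mk_one_mem_of_normal hF L' hxy hx (upperOne K)
      refine htop h1 ((hL' _ _).2 ?_)
      rw [hL', Matrix.SpecialLinearGroup.coe_one, hone,
        coe_upperOne_eq_map ℚ K (algebraMap ℚ K)] at h1
      rw [Matrix.SpecialLinearGroup.coe_one, hone, coe_upperOne_eq_map ℚ K (algebraMap ℚ K)]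
      exact hLQ.pairMatrix_swap_mem b hi hτ h1
    · have h1 := one_mk_mem_of_normal hF L' hxy hy (upperOne K)
      refine htop ((hL' _ _).2 ?_) h1
      rw [hL', Matrix.SpecialLinearGroup.coe_one, hone,
        coe_upperOne_eq_map ℚ K (algebraMap ℚ K)] at h1
      rw [Matrix.SpecialLinearGroup.coe_one, hone, coe_upperOne_eq_map ℚ K (algebraMap ℚ K)]
      exact hLQ.pairMatrix_swap_mem b hi hτ h1
  · left
    push Not at hcen
    -- Here both components of every element are central, and the center of `SL₂(K)` is finite.
    have hfin : (points L).Finite := by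
      refine (((finite_center_specialLinearGroup (Fin 2) K).prod
        (finite_center_specialLinearGroup (Fin 2) K)).image fun g =>
          entries (pairMatrix b τ (g.1 : Matrix (Fin 2) (Fin 2) K) g.2)).subset ?_
      rintro _ ⟨g, hg, rfl⟩
      obtain ⟨⟨x, y⟩, hxy⟩ := (pairEquiv hi b (Fin 2)).surjective ⟨g, hLH hg⟩
      have hmem : (x, y) ∈ L' := by
        change (pairEquiv hi b (Fin 2) (x, y) : Matrix.SpecialLinearGroup _ K) ∈ L
        rwa [hxy]
      refine ⟨(x, y), hcen x y hmem, ?_⟩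
      dsimp only
      rw [← coe_pairEquiv hi b hτ, hxy]
    have hsub := subsingleton_of_finite_of_isConnected hfin hLc
    rw [Subgroup.eq_bot_iff_forall]
    intro g hg
    have := hsub (entries_mem_points.2 hg) (entries_mem_points.2 L.one_mem)
    ext s t
    exact congrFun this (s, t)

end Simplicity

end LinAlgGroup

end

theorem mainTheorem9 {K : Type*} [Field K] [IsAlgClosed K] [CharZero K]
    (i : K) (hi : i ^ 2 = -1)
    {ι : Type*} [Fintype ι] [DecidableEq ι]
    (b : Module.Basis ι ℚ (IntermediateField.adjoin ℚ {i})) :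
    LinAlgGroup.IsSimpleOver ℚ (LinAlgGroup.restrictScalarsSL K (Fin 2) b) ∧
    ¬ LinAlgGroup.IsSimpleOver K (LinAlgGroup.restrictScalarsSL K (Fin 2) b) ∧
    ∃ ρ : LinAlgGroup.restrictScalarsSL K (Fin 2) b ≃*
        LinAlgGroup.prod (⊤ : Subgroup (Matrix.SpecialLinearGroup (Fin 2) K))
          (⊤ : Subgroup (Matrix.SpecialLinearGroup (Fin 2) K)),
      LinAlgGroup.IsIsomorphismOver (IntermediateField.adjoin ℚ {i}) ρ ∧
      (∃ τ : IntermediateField.adjoin ℚ {i} ≃ₐ[ℚ] IntermediateField.adjoin ℚ {i},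
        τ (IntermediateField.AdjoinSimple.gen ℚ i) = -IntermediateField.AdjoinSimple.gen ℚ i ∧
        LinAlgGroup.IsConjugateBy (K := K) τ.toAlgHom.toRingHom ρ
          (fun g => LinAlgGroup.swapFactors ⊤ (ρ g))) ∧
      ∀ σ : K ≃+* K, σ i = -i →
        ∀ g : LinAlgGroup.restrictScalarsSL K (Fin 2) b,
          ∃ g' : LinAlgGroup.restrictScalarsSL K (Fin 2) b,
            (g' : Matrix.SpecialLinearGroup (Fin 2 × ι) K) =
              Matrix.SpecialLinearGroup.map (σ : K →+* K)
                (g : Matrix.SpecialLinearGroup (Fin 2 × ι) K) ∧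
            (ρ g' : Matrix.SpecialLinearGroup (Fin 2 ⊕ Fin 2) K) =
              Matrix.SpecialLinearGroup.map (σ : K →+* K)
                (LinAlgGroup.swapFactors ⊤ (ρ g) :
                  Matrix.SpecialLinearGroup (Fin 2 ⊕ Fin 2) K) := by
  obtain ⟨τ, hτ⟩ := LinAlgGroup.exists_conj hi
  exact ⟨LinAlgGroup.isSimpleOver_restrictScalarsSL hi b,
    LinAlgGroup.not_isSimpleOver_restrictScalarsSL hi b,
    LinAlgGroup.restrictScalarsEquivProd hi b (Fin 2),
    LinAlgGroup.isIsomorphismOver_restrictScalarsEquivProd hi b hτ,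
    ⟨τ, hτ, LinAlgGroup.isConjugateBy_restrictScalarsEquivProd hi b hτ⟩,
    fun _ hσ g => LinAlgGroup.exists_map_eq hi b hσ g⟩
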